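/- Let $G$ be a connected real Lie group with Lie algebra $\mathfrak g$, let $s$ be a (smooth) automorphism of $G$ of order $3$, let $G^s$ be its fixed point group with identity component $G^s_0$, and let $H$ be a subgroup with $G^s_0\subset H\subset G^s$. Let $\mathfrak h=\ker(s_*-1)\subset\mathfrak g$ and let $\mathfrak m=(\mathfrak m^+\oplus\mathfrak m^-)\cap\mathfrak g=\ker(s_*^2+s_*+1)$, where $\mathfrak m^\pm\subset\mathfrak g\otimes\mathbb C$ are the eigenspaces of $s_*$ for the eigenvalues $\frac12(-1\pm\sqrt{-3})$, so that $\mathfrak g=\mathfrak h\oplus\mathfrak m$; write $X_{\mathfrak m}$ for the $\mathfrak m$-component of $X$. Let $J$ be the complex structure on $\mathfrak m$ with $s_*|_{\mathfrak m}=-\frac12\,\mathrm{Id}+\frac{\sqrt3}{2}J$, and let $B$ be an $\mathrm{Ad}(H)$-invariant and $s_*$-invariant (positive definite or, more generally, nondegenerate symmetric) scalar product on $\mathfrak m$ that is naturally reductive: $$B([X,Y]_{\mathfrak m},Z)=B(X,[Y,Z]_{\mathfrak m})\qquad\text{for all }X,Y,Z\in\mathfrak m .$$ Equip $M=G/H$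 (with its quotient manifold structure) with the $G$-invariant almost complex structure $J$ and the $G$-invariant (pseudo-)Riemannian metric $g$ that are given at the base point by $J$ and $B$ on $\mathfrak m\cong T_{eH}M$; this is the (pseudo-)nearly Kähler structure of the naturally reductive three-symmetric space $G/H$. Let $f:L\to M$ be an invariant Lagrangian submanifold, that is, a smooth immersion such that - (Lagrangian) $2\dim L=\dim M$, the induced metric $f^*g$ is nondegenerate (automatic if $B$ is positive definite), and $g(J\,df(u),df(v))=0$ for all $x\in L$, $u,v\in T_xL$; - (invariant) $L$ is an integral manifold of a left invariant distribution: there is a $G$-invariant distribution $D\subset TM$ with $df(T_xL)=D_{f(x)}$ for all $x\in L$. Then $L$ is totally geodesic, i.e. its second fundamental form with respect to the Levi-Civita connection of $g$ vanishes. In particular $L$ is minimal, i.e. its mean curvature vector (the trace of the second fundamental form with respect to the induced metric) vanishes. -/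

import Mathlib

open scoped Manifold ContDiff

noncomputable section

/-! ## Pseudo-Riemannian geometry of an immersion

`M` and `N` are manifolds without boundary modelled on the finite-dimensional spaces `F`, `E'`.
In Mathlib the tangent space at `p` is read in the preferred chart at `p`, so that the derivative
of that chart at `p` is the identity. -/

section PseudoRiemannian

variable {F : Type*} [NormedAddCommGroup F] [NormedSpace ℝ F]
  {M : Type*} [TopologicalSpace M] [ChartedSpace F M]
  {E' : Type*} [NormedAddCommGroup E'] [NormedSpace ℝ E']
  {N : Type*} [TopologicalSpace N] [ChartedSpace E' N]

variable (F M) in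
/-- Fields of bilinear forms on the tangent spaces of `M`, for instance metrics. -/
abbrev BilinField : Type _ :=
  (q : M) → TangentSpace 𝓘(ℝ, F) q →L[ℝ] TangentSpace 𝓘(ℝ, F) q →L[ℝ] ℝ

/-- The pull-back `(u, v) ↦ b (A u) (A v)` of a bilinear form under a linear map. -/
def pullbackForm {V W : Type*} [TopologicalSpace V] [AddCommGroup V] [Module ℝ V]
    [IsTopologicalAddGroup V] [ContinuousSMul ℝ V]
    [TopologicalSpace W] [AddCommGroup W] [Module ℝ W]
    [IsTopologicalAddGroup W] [ContinuousSMul ℝ W]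
    (b : W →L[ℝ] W →L[ℝ] ℝ) (A : V →L[ℝ] W) : V →L[ℝ] V →L[ℝ] ℝ :=
  (ContinuousLinearMap.precomp ℝ A).comp (b.comp A)

/-- The coordinate expression of the metric `g` in the preferred chart at `p`:
`y ↦ (g_{ij}(y))`, as a bilinear form on the model space. -/
def coordMetric (g : BilinField F M) (p : M) (y : F) : F →L[ℝ] F →L[ℝ] ℝ :=
  pullbackForm (g ((extChartAt 𝓘(ℝ, F) p).symm y))
    (mfderiv 𝓘(ℝ, F) 𝓘(ℝ, F) (extChartAt 𝓘(ℝ, F) p).symm y)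

/-- The Christoffel symbol at `p` of the Levi-Civita connection of `g`, in the preferred chart
at `p`: the vector `Γ(a, b)` with
`2 g(Γ(a, b), c) = (∂_a g)(b, c) + (∂_b g)(a, c) - (∂_c g)(a, b)` for all `c`. -/
def christoffel (g : BilinField F M) (p : M) (a b : F) : F :=
  let y := extChartAt 𝓘(ℝ, F) p p
  let Dg : F →L[ℝ] F →L[ℝ] F →L[ℝ] ℝ := fderiv ℝ (coordMetric g p) y
  (coordMetric g p y).inverse ((1 / 2 : ℝ) • (Dg a b + Dg b a - (Dg.flip a).flip b))

/-- The covariant derivative `∇_u (df V)` at `x`, where `∇` is the Levi-Civita connection of `g`,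
`f : N → M` is a smooth map and `V` is the vector field near `x` with `V x = v` that is constant
in the preferred chart at `x`. In coordinates it is `∂_u ∂_v f + Γ(df u, df v)`.
Another extension `V` of `v` changes the value by a vector in the range of `df`. -/
def covDerivAlong (g : BilinField F M) (f : N → M) (x : N) (u v : TangentSpace 𝓘(ℝ, E') x) :
    TangentSpace 𝓘(ℝ, F) (f x) :=
  let φ : E' → F := writtenInExtChartAt 𝓘(ℝ, E') 𝓘(ℝ, F) x f
  let y : E' := extChartAt 𝓘(ℝ, E') x x
  let df := mfderiv 𝓘(ℝ, E') 𝓘(ℝ, F) f x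
  (fderiv ℝ (fderiv ℝ φ) y u v + christoffel g (f x) (df u) (df v) : F)

/-- The induced bilinear form `f^* g` on the tangent space of `N` at `x`. -/
def inducedMetric (g : BilinField F M) (f : N → M) : BilinField E' N := fun x =>
  pullbackForm (g (f x)) (mfderiv 𝓘(ℝ, E') 𝓘(ℝ, F) f x)

variable (E') in
/-- The component of `w` in the tangent space `df (T_x N)`: the vector `df u` for the `u` with
`(f^* g)(u, u') = g(w, df u')` for all `u'`. -/
def tangentPart (g : BilinField F M) (f : N → M) (x : N) (w : TangentSpace 𝓘(ℝ, F) (f x)) :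
    TangentSpace 𝓘(ℝ, F) (f x) :=
  mfderiv 𝓘(ℝ, E') 𝓘(ℝ, F) f x
    ((inducedMetric (E' := E') g f x).inverse ((g (f x) w).comp (mfderiv 𝓘(ℝ, E') 𝓘(ℝ, F) f x)))

/-- The second fundamental form of the immersion `f`: `II(u, v)` is the component of
`∇_u (df V)`, `V x = v`, that is normal to `f`. -/
def secondFundamentalForm (g : BilinField F M) (f : N → M) (x : N)
    (u v : TangentSpace 𝓘(ℝ, E') x) : TangentSpace 𝓘(ℝ, F) (f x) :=
  covDerivAlong g f x u v - tangentPart E' g f x (covDerivAlong g f x u v)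

/-- The (unnormalized) mean curvature vector, the trace `∑_{i,j} h^{ij} II(b_i, b_j)` of the second
fundamental form with respect to the induced metric `h`; here `h⁻¹ bⁱ = ∑_j h^{ij} b_j` for the
dual basis `(bⁱ)`. The value does not depend on the basis. -/
def meanCurvature [FiniteDimensional ℝ E'] (g : BilinField F M) (f : N → M) (x : N) :
    TangentSpace 𝓘(ℝ, F) (f x) :=
  let b := Module.finBasis ℝ E'
  ∑ i, secondFundamentalForm g f x (b i)
    ((inducedMetric (E' := E') g f x).inverse (LinearMap.toContinuousLinearMap (b.coord i) : E' →L[ℝ] ℝ))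

/-- `f` is totally geodesic: its second fundamental form vanishes. -/
def IsTotallyGeodesic (g : BilinField F M) (f : N → M) : Prop :=
  ∀ (x : N) (u v : TangentSpace 𝓘(ℝ, E') x), secondFundamentalForm g f x u v = 0

/-- `f` is minimal: its mean curvature vanishes. -/
def IsMinimal [FiniteDimensional ℝ E'] (g : BilinField F M) (f : N → M) : Prop :=
  ∀ x : N, meanCurvature (E' := E') g f x = 0

/-- `f : N → M` is a Lagrangian immersion into the almost Hermitian manifold `(M, J, g)`: a smooth
immersion of half the dimension, with nondegenerate induced metric (automatic when `g` is
positive definite), on which `ω = g(J·, ·)` vanishes. -/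
structure IsLagrangian (g : BilinField F M)
    (J : (q : M) → TangentSpace 𝓘(ℝ, F) q →L[ℝ] TangentSpace 𝓘(ℝ, F) q) (f : N → M) : Prop where
  immersion : Manifold.IsImmersion 𝓘(ℝ, E') 𝓘(ℝ, F) ∞ f
  dim : 2 * Module.finrank ℝ E' = Module.finrank ℝ F
  nondegenerate : ∀ (x : N) (u : TangentSpace 𝓘(ℝ, E') x),
    (∀ v, inducedMetric g f x u v = 0) → u = 0
  isotropic : ∀ (x : N) (u v : TangentSpace 𝓘(ℝ, E') x),
    g (f x) (J (f x) (mfderiv 𝓘(ℝ, E') 𝓘(ℝ, F) f x u)) (mfderiv 𝓘(ℝ, E') 𝓘(ℝ, F) f x v) = 0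

end PseudoRiemannian

/-! ## Three-symmetric spaces -/

section ThreeSymmetric

variable {E : Type*} [NormedAddCommGroup E] [NormedSpace ℝ E]
  {G : Type*} [TopologicalSpace G] [ChartedSpace E G] [Group G]

/-- `s` is an automorphism of order three of the Lie group `G`, and the subgroup `H` lies between
the identity component of the fixed point group of `s` and the fixed point group. -/
structure IsThreeSymmetricPair (s : MulAut G) (H : Subgroup G) : Prop where
  smooth : ContMDiff 𝓘(ℝ, E) 𝓘(ℝ, E) ∞ s
  order : orderOf s = 3
  component_le : connectedComponentIn {x : G | s x = x} 1 ⊆ (H : Set G)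
  le_fixed : ∀ h ∈ H, s h = h

/-- The differential `s_*` of `s` at the identity. -/
def sStar (s : MulAut G) : GroupLieAlgebra 𝓘(ℝ, E) G →L[ℝ] GroupLieAlgebra 𝓘(ℝ, E) G :=
  (mfderiv 𝓘(ℝ, E) 𝓘(ℝ, E) s (1 : G) : E →L[ℝ] E)

/-- The adjoint representation: `Ad a` is the differential of `x ↦ a x a⁻¹` at the identity. -/
def Ad (a : G) : GroupLieAlgebra 𝓘(ℝ, E) G →L[ℝ] GroupLieAlgebra 𝓘(ℝ, E) G :=
  (mfderiv 𝓘(ℝ, E) 𝓘(ℝ, E) (fun x : G => a * x * a⁻¹) (1 : G) : E →L[ℝ] E)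

/-- The subspace `𝔥` of `𝔤`: the eigenspace of `s_*` for the eigenvalue `1`. -/
def hPart (s : MulAut G) : Submodule ℝ (GroupLieAlgebra 𝓘(ℝ, E) G) where
  carrier := {X | sStar s X = X}
  add_mem' {X Y} hX hY := by
    change sStar s (X + Y) = X + Y
    rw [map_add, show sStar s X = X from hX, show sStar s Y = Y from hY]
  zero_mem' := map_zero (sStar s)
  smul_mem' c X hX := by
    change sStar s (c • X) = c • X
    rw [map_smul, show sStar s X = X from hX]

/-- The subspace `𝔪 = (𝔪⁺ ⊕ 𝔪⁻) ∩ 𝔤` of `𝔤`, where `𝔪^±` are the eigenspaces of `s_*` on the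
complexification for the primitive third roots of unity, that is, for the two roots of
`z² + z + 1`. -/
def mPart (s : MulAut G) : Submodule ℝ (GroupLieAlgebra 𝓘(ℝ, E) G) where
  carrier := {X | sStar s (sStar s X) + sStar s X + X = 0}
  add_mem' {X Y} hX hY := by
    change sStar s (sStar s (X + Y)) + sStar s (X + Y) + (X + Y) = 0
    have hX' : sStar s (sStar s X) + sStar s X + X = 0 := hX
    have hY' : sStar s (sStar s Y) + sStar s Y + Y = 0 := hY
    rw [map_add, map_add]
    calc _ = (sStar s (sStar s X) + sStar s X + X) + (sStar s (sStar s Y) + sStar s Y + Y) := by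
          abel
      _ = 0 := by rw [hX', hY', add_zero]
  zero_mem' := by
    change sStar s (sStar s 0) + sStar s 0 + 0 = 0
    rw [map_zero, map_zero, add_zero, add_zero]
  smul_mem' c X hX := by
    change sStar s (sStar s (c • X)) + sStar s (c • X) + c • X = 0
    have hX' : sStar s (sStar s X) + sStar s X + X = 0 := hX
    rw [map_smul, map_smul, ← smul_add, ← smul_add, hX', smul_zero]

/-- The canonical complex structure on `𝔪`, defined by `s_* = -1/2 + (√3/2) J`. -/
def mComplex (s : MulAut G) : mPart (E := E) s →L[ℝ] mPart (E := E) s :=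
  ((2 / √3 : ℝ) • ((sStar s).comp (mPart s).subtypeL + (1 / 2 : ℝ) • (mPart s).subtypeL)).codRestrict
    (mPart s) (fun X => by
      have h : sStar s (X : GroupLieAlgebra 𝓘(ℝ, E) G) ∈ mPart (E := E) s := by
        have hX : sStar s (sStar s (X : GroupLieAlgebra 𝓘(ℝ, E) G))
          + sStar s (X : GroupLieAlgebra 𝓘(ℝ, E) G) + (X : GroupLieAlgebra 𝓘(ℝ, E) G) = 0 := X.2
        change sStar s (sStar s (sStar s (X : GroupLieAlgebra 𝓘(ℝ, E) G)))
          + sStar s (sStar s (X : GroupLieAlgebra 𝓘(ℝ, E) G))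
          + sStar s (X : GroupLieAlgebra 𝓘(ℝ, E) G) = 0
        rw [← map_add, ← map_add, hX, map_zero]
      exact (mPart s).smul_mem _ ((mPart s).add_mem h ((mPart s).smul_mem _ X.2)))

/-- `U` is the component `X_𝔪` of `X` in the decomposition `𝔤 = 𝔥 ⊕ 𝔪`. -/
def IsMComponent (s : MulAut G) (X : GroupLieAlgebra 𝓘(ℝ, E) G) (U : mPart (E := E) s) : Prop :=
  X - U ∈ hPart (E := E) s

/-- `B` is an `Ad(H)`-invariant and `s_*`-invariant pseudo-Euclidean scalar product on `𝔪`. -/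
structure IsInvariantScalarProduct (s : MulAut G) (H : Subgroup G)
    (B : mPart (E := E) s →L[ℝ] mPart (E := E) s →L[ℝ] ℝ) : Prop where
  symm : ∀ X Y, B X Y = B Y X
  nondegenerate : ∀ X, (∀ Y, B X Y = 0) → X = 0
  ad_invariant : ∀ h ∈ H, ∀ X Y X' Y' : mPart (E := E) s,
    Ad h (X : GroupLieAlgebra 𝓘(ℝ, E) G) = X' → Ad h (Y : GroupLieAlgebra 𝓘(ℝ, E) G) = Y' →
      B X' Y' = B X Y
  s_invariant : ∀ X Y X' Y' : mPart (E := E) s,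
    sStar s (X : GroupLieAlgebra 𝓘(ℝ, E) G) = X' → sStar s (Y : GroupLieAlgebra 𝓘(ℝ, E) G) = Y' →
      B X' Y' = B X Y

/-- The decomposition `𝔤 = 𝔥 ⊕ 𝔪` is naturally reductive with respect to `B`:
`B([X, Y]_𝔪, Z) = B(X, [Y, Z]_𝔪)` for `X`, `Y`, `Z` in `𝔪`. -/
def IsNaturallyReductive (s : MulAut G)
    (B : mPart (E := E) s →L[ℝ] mPart (E := E) s →L[ℝ] ℝ) : Prop :=
  ∀ X Y Z U V : mPart (E := E) s,
    IsMComponent s ⁅(X : GroupLieAlgebra 𝓘(ℝ, E) G), (Y : GroupLieAlgebra 𝓘(ℝ, E) G)⁆ U →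
    IsMComponent s ⁅(Y : GroupLieAlgebra 𝓘(ℝ, E) G), (Z : GroupLieAlgebra 𝓘(ℝ, E) G)⁆ V →
      B U Z = B X V

variable {F : Type*} [NormedAddCommGroup F] [NormedSpace ℝ F] {H : Subgroup G}
  [ChartedSpace F (G ⧸ H)]

variable (E F H) in
/-- The manifold structure of `G ⧸ H` is the quotient one: the projection `G → G ⧸ H` is a smooth
submersion. -/
def IsQuotientManifold : Prop :=
  Manifold.IsSubmersion 𝓘(ℝ, E) 𝓘(ℝ, F) ∞ (QuotientGroup.mk : G → G ⧸ H)

/-- The identification `𝔪 ≅ T_{aH}(G/H)` given by `a`: the left translation by `a` followed by the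
projection. -/
def mToTangent (s : MulAut G) (a : G) :
    mPart (E := E) s →L[ℝ] TangentSpace 𝓘(ℝ, F) (a : G ⧸ H) :=
  (mfderiv 𝓘(ℝ, E) 𝓘(ℝ, F) (fun x : G => ((a * x : G) : G ⧸ H)) (1 : G) : E →L[ℝ] F).comp
    (mPart (E := E) s).subtypeL

/-- The identification `T_q(G/H) ≅ 𝔪` given by a representative of `q`. -/
def tangentToM (s : MulAut G) (q : G ⧸ H) :
    TangentSpace 𝓘(ℝ, F) q →L[ℝ] mPart (E := E) s :=
  (mToTangent (E := E) (F := F) (H := H) s q.out).inverse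

/-- The `G`-invariant metric on `G/H` that is `B` on `𝔪`. For `Ad(H)`-invariant `B` it does not
depend on the representatives. -/
def invariantMetric (s : MulAut G) (B : mPart (E := E) s →L[ℝ] mPart (E := E) s →L[ℝ] ℝ) :
    BilinField F (G ⧸ H) := fun q =>
  pullbackForm B (tangentToM (E := E) (F := F) s q)

/-- The `G`-invariant almost complex structure on `G/H` that is `J` on `𝔪`. -/
def invariantComplex (s : MulAut G) (q : G ⧸ H) :
    TangentSpace 𝓘(ℝ, F) q →L[ℝ] TangentSpace 𝓘(ℝ, F) q :=
  ((mToTangent (E := E) (F := F) (H := H) s q.out : _ →L[ℝ] F).comp (mComplex (E := E) s)).comp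
    (tangentToM (E := E) (F := F) s q)

/-- `f : N → G/H` is an invariant submanifold: an integral manifold of a left invariant (that is,
`G`-invariant) distribution `D` on `G/H`. -/
def IsInvariantSubmanifold {E' : Type*} [NormedAddCommGroup E'] [NormedSpace ℝ E']
    {N : Type*} [TopologicalSpace N] [ChartedSpace E' N] (f : N → G ⧸ H) : Prop :=
  ∃ D : (q : G ⧸ H) → Submodule ℝ (TangentSpace 𝓘(ℝ, F) q),
    (∀ (a : G) (q : G ⧸ H),
      (D q).map (mfderiv 𝓘(ℝ, F) 𝓘(ℝ, F) (fun r : G ⧸ H => a • r) q).toLinearMap = D (a • q)) ∧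
    ∀ x : N, (mfderiv 𝓘(ℝ, E') 𝓘(ℝ, F) f x).toLinearMap.range = D (f x)

end ThreeSymmetric

end

/-! Behind the theorem is the canonical connection of `G/H`. Every `G`-invariant distribution is
parallel for it, and natural reductivity makes its torsion totally skew, so that it has the same
symmetrized covariant derivative as the Levi-Civita connection. Along an integral manifold of an
invariant distribution the canonical derivative of a tangent field is tangent. Hence so is the
symmetrized Levi-Civita derivative, and the second fundamental form, being symmetric, vanishes.

The proof expresses this through a local coframe instead of a connection. Pull the left
Maurer-Cartan form back under a local section of `G → G/H` and project it to `𝔪`. The result `Θ`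
satisfies `g = B(Θ, Θ)`, and if the section is horizontal at the point considered then `dΘ = -[Θ,
Θ]_𝔪` there (`IsQuotientManifold.exists_coframe`). Since `B([X, Y]_𝔪, Z)` is totally skew, the
Koszul formula reduces to `Θ(Γ(u, v)) = ½(∂_uΘ(v) + ∂_vΘ(u))` (`koszul_of_coframe`,
`coframe_christoffel`).

An invariant distribution is `{Θ ∈ 𝔡}` for one fixed subspace `𝔡`
(`IsQuotientManifold.orbitDeriv_mem_iff`). Differentiating `Θ(dφ(v)) ∈ 𝔡` in the direction `u` and
symmetrizing gives `Θ(∂_u∂_vφ + Γ(dφ u, dφ v)) ∈ 𝔡` (`second_deriv_mem_of_coframe`), so the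
covariant derivative is tangent (`covDerivAlong_mem_range`). Its normal part is then zero, because
the induced metric is nondegenerate. -/

noncomputable section

open Filter Topology

/-! ### Calculus in vector spaces: Koszul formula, distributions, Maurer-Cartan equation. -/

section Flat

variable {E : Type*} [NormedAddCommGroup E] [NormedSpace ℝ E]
  {F : Type*} [NormedAddCommGroup F] [NormedSpace ℝ F]
  {W : Type*} [NormedAddCommGroup W] [NormedSpace ℝ W]

/-- `ContinuousLinearMap.inverse` is zero on maps that are not invertible. A nondegenerate form is
injective into the dual, which has the same dimension, so here the inverse is genuine. This serves
both the Christoffel symbol and the tangential projection. -/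
theorem inverse_apply_apply_of_injective [FiniteDimensional ℝ E] (T : E →L[ℝ] E →L[ℝ] ℝ)
    (hT : ∀ u, (∀ v, T u v = 0) → u = 0) (u : E) : T.inverse (T u) = u := by
  have hinj : Function.Injective T := by
    rw [injective_iff_map_eq_zero]
    exact fun u hu => hT u fun v => by simp [hu]
  have hfin : Module.finrank ℝ E = Module.finrank ℝ (E →L[ℝ] ℝ) := by
    rw [← Subspace.dual_finrank_eq (K := ℝ) (V := E)]
    exact (LinearMap.toContinuousLinearMap (𝕜 := ℝ) (E := E) (F' := ℝ)).finrank_eq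
  have hbij : Function.Bijective T.toLinearMap :=
    ⟨hinj, (LinearMap.injective_iff_surjective_of_finrank_eq_finrank hfin).1 hinj⟩
  let e : E ≃L[ℝ] (E →L[ℝ] ℝ) :=
    (LinearEquiv.ofBijective T.toLinearMap hbij).toContinuousLinearEquiv
  have he : T = (e : E →L[ℝ] E →L[ℝ] ℝ) := by ext; rfl
  rw [he, ContinuousLinearMap.inverse_equiv]
  exact e.symm_apply_apply u

theorem pullbackForm_apply (b : W →L[ℝ] W →L[ℝ] ℝ) (A : F →L[ℝ] W) (u v : F) :
    pullbackForm b A u v = b (A u) (A v) := rfl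

theorem differentiableAt_pullbackForm (b : W →L[ℝ] W →L[ℝ] ℝ) {Θ : F → F →L[ℝ] W} {y : F}
    (hΘ : DifferentiableAt ℝ Θ y) : DifferentiableAt ℝ (fun z => pullbackForm b (Θ z)) y := by
  have h1 := DifferentiableAt.comp (F := F →L[ℝ] W) (G := (W →L[ℝ] ℝ) →L[ℝ] F →L[ℝ] ℝ) y
    ((ContinuousLinearMap.compL ℝ F W ℝ).flip.hasFDerivAt (x := Θ y)).differentiableAt hΘ
  exact h1.clm_comp ((differentiableAt_const _).clm_comp hΘ)

theorem fderiv_pullbackForm_apply (b : W →L[ℝ] W →L[ℝ] ℝ) {Θ : F → F →L[ℝ] W} {y : F}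
    (hΘ : DifferentiableAt ℝ Θ y) (u v w : F) :
    fderiv ℝ (fun z => pullbackForm b (Θ z)) y u v w =
      b (fderiv ℝ Θ y u v) (Θ y w) + b (Θ y v) (fderiv ℝ Θ y u w) := by
  have h := (differentiableAt_pullbackForm b hΘ).hasFDerivAt
  have h1 := (h.clm_apply (hasFDerivAt_const v y)).clm_apply (hasFDerivAt_const w y)
  have hv := hΘ.hasFDerivAt.clm_apply (hasFDerivAt_const v y)
  have hw := hΘ.hasFDerivAt.clm_apply (hasFDerivAt_const w y)
  have h2 := ((b.hasFDerivAt.comp y hv)).clm_apply hw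
  have h3 := congrArg (fun T => T u) (h1.unique h2)
  simp at h3
  rw [h3]
  simp [add_comm]

/-- The Koszul formula for a coframe `Θ` whose exterior derivative is totally skew. -/
theorem koszul_of_coframe (b : W →L[ℝ] W →L[ℝ] ℝ) (hb : ∀ X Y, b X Y = b Y X)
    {Θ : F → F →L[ℝ] W} {y : F} (hΘ : DifferentiableAt ℝ Θ y)
    (hskew : ∀ u v w, b (Θ y v) (fderiv ℝ Θ y u w - fderiv ℝ Θ y w u) +
      b (Θ y u) (fderiv ℝ Θ y v w - fderiv ℝ Θ y w v) = 0)
    (u v γ : F) (hγ : Θ y γ = (1 / 2 : ℝ) • (fderiv ℝ Θ y u v + fderiv ℝ Θ y v u)) :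
    pullbackForm b (Θ y) γ =
      (1 / 2 : ℝ) • (fderiv ℝ (fun z => pullbackForm b (Θ z)) y u v +
        fderiv ℝ (fun z => pullbackForm b (Θ z)) y v u -
        ((fderiv ℝ (fun z => pullbackForm b (Θ z)) y).flip u).flip v) := by
  ext w
  have h := hskew u v w
  simp only [smul_apply, add_apply, sub_apply, ContinuousLinearMap.flip_apply, pullbackForm_apply,
    fderiv_pullbackForm_apply b hΘ, hγ, map_smul, map_add, map_sub, smul_eq_mul] at h ⊢
  -- With this term reordered, the two sides differ exactly by half of the skewness relation `h`.
  rw [hb (fderiv ℝ Θ y w u) (Θ y v)]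
  linarith

/-- If the differential of `φ` takes values in the distribution `{Θ ∈ D}`, then so does
the symmetrized second derivative of `φ`. -/
theorem second_deriv_mem_of_coframe {V : Type*} [NormedAddCommGroup V] [NormedSpace ℝ V]
    [FiniteDimensional ℝ W] {Θ : F → F →L[ℝ] W} {φ : V → F} {z : V}
    (hφ : ContDiffAt ℝ 2 φ z) (hΘ : DifferentiableAt ℝ Θ (φ z)) (D : Submodule ℝ W)
    (hD : ∀ᶠ z' in 𝓝 z, ∀ v, Θ (φ z') (fderiv ℝ φ z' v) ∈ D) (u v : V) :
    Θ (φ z) (fderiv ℝ (fderiv ℝ φ) z u v) +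
      (1 / 2 : ℝ) • (fderiv ℝ Θ (φ z) (fderiv ℝ φ z u) (fderiv ℝ φ z v) +
        fderiv ℝ Θ (φ z) (fderiv ℝ φ z v) (fderiv ℝ φ z u)) ∈ D := by
  have hφ1 : HasFDerivAt φ (fderiv ℝ φ z) z := (hφ.differentiableAt (by norm_num)).hasFDerivAt
  have hφ2 : HasFDerivAt (fderiv ℝ φ) (fderiv ℝ (fderiv ℝ φ) z) z :=
    ((hφ.fderiv_right (m := 1) (by norm_num)).differentiableAt (by norm_num)).hasFDerivAt
  have key : ∀ u v, fderiv ℝ Θ (φ z) (fderiv ℝ φ z u) (fderiv ℝ φ z v) +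
      Θ (φ z) (fderiv ℝ (fderiv ℝ φ) z u v) ∈ D := by
    intro u v
    have h := (hΘ.hasFDerivAt.comp z hφ1).clm_apply (hφ2.clm_apply (hasFDerivAt_const v z))
    -- The difference quotients lie in `D`, which is closed because `W` is finite-dimensional; hence
    -- so does their limit, the derivative.
    have hcl : IsClosed (D : Set W) := D.closed_of_finiteDimensional
    have hmem : ∀ᶠ z' in 𝓝 z, (Θ ∘ φ) z' (fderiv ℝ φ z' v) ∈ D := by
      filter_upwards [hD] with z' hz' using hz' v
    have hl := (h.hasLineDerivAt u).tendsto_slope_zero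
    have : fderiv ℝ Θ (φ z) (fderiv ℝ φ z u) (fderiv ℝ φ z v) +
      Θ (φ z) (fderiv ℝ (fderiv ℝ φ) z u v) ∈ (D : Set W) := by
      refine hcl.mem_of_tendsto (b := 𝓝[≠] (0 : ℝ)) (f := _) (by simpa [add_comm] using hl) ?_
      have ht : Tendsto (fun t : ℝ => z + t • u) (𝓝[≠] 0) (𝓝 z) := by
        have : Continuous (fun t : ℝ => z + t • u) := by fun_prop
        simpa using (this.tendsto 0).mono_left nhdsWithin_le_nhds
      filter_upwards [ht.eventually hmem] with t htm
      exact D.smul_mem _ (D.sub_mem htm (by simpa using hmem.self_of_nhds))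
    exact this
  have hs : fderiv ℝ (fderiv ℝ φ) z u v = fderiv ℝ (fderiv ℝ φ) z v u :=
    (hφ.isSymmSndFDerivAt (by simp)).eq u v
  have := D.smul_mem (1 / 2 : ℝ) (D.add_mem (key u v) (key v u))
  rw [← hs] at this
  convert! this using 1
  module

/-- The derivative at a point of the left Maurer-Cartan form of a local group law, pulled back under
a map `n` into the group with pointwise inverse `ι`. -/
theorem maurerCartan_of_groupLaw {μ : E × E → E} {c : E} (hμ : ContDiffAt ℝ 2 μ (c, c))
    (hl : ∀ᶠ Y in 𝓝 c, μ (c, Y) = Y) (hr : ∀ᶠ X in 𝓝 c, μ (X, c) = X)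
    {n ι : F → E} {y : F} (hn : ContDiffAt ℝ 2 n y) (hι : ContDiffAt ℝ 2 ι y)
    (hny : n y = c) (hιy : ι y = c) (hinv : ∀ᶠ x in 𝓝 y, μ (ι x, n x) = c) :
    let η : F → F →L[ℝ] E := fun x => fderiv ℝ (fun z => μ (ι x, n z)) x
    let β : E → E → E := fun v w => fderiv ℝ (fun X => fderiv ℝ (fun Y => μ (X, Y)) c w) c v
    DifferentiableAt ℝ η y ∧ η y = fderiv ℝ n y ∧ ∀ u v, fderiv ℝ η y u v - fderiv ℝ η y v u =
      -(β (fderiv ℝ n y u) (fderiv ℝ n y v) - β (fderiv ℝ n y v) (fderiv ℝ n y u)) := by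
  intro η β
  have hμ1 : HasFDerivAt μ (fderiv ℝ μ (c, c)) (c, c) :=
    (hμ.differentiableAt (by norm_num)).hasFDerivAt
  have hμ2 : HasFDerivAt (fderiv ℝ μ) (fderiv ℝ (fderiv ℝ μ) (c, c)) (c, c) :=
    ((hμ.fderiv_right (m := 1) (by norm_num)).differentiableAt (by norm_num)).hasFDerivAt
  have hμe : ∀ᶠ p in 𝓝 (c, c), DifferentiableAt ℝ μ p := by
    filter_upwards [hμ.eventually (by simp)] with p hp using hp.differentiableAt (by norm_num)
  have hne : ∀ᶠ x in 𝓝 y, DifferentiableAt ℝ n x := by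
    filter_upwards [hn.eventually (by simp)] with p hp using hp.differentiableAt (by norm_num)
  have hn1 : HasFDerivAt n (fderiv ℝ n y) y := (hn.differentiableAt (by norm_num)).hasFDerivAt
  have hn2 : HasFDerivAt (fderiv ℝ n) (fderiv ℝ (fderiv ℝ n) y) y :=
    ((hn.fderiv_right (m := 1) (by norm_num)).differentiableAt (by norm_num)).hasFDerivAt
  have hι1 : HasFDerivAt ι (fderiv ℝ ι y) y := (hι.differentiableAt (by norm_num)).hasFDerivAt
  have hpair : HasFDerivAt (fun x => (ι x, n x)) ((fderiv ℝ ι y).prod (fderiv ℝ n y)) y :=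
    hι1.prodMk hn1
  have hpy : (ι y, n y) = (c, c) := by rw [hny, hιy]
  have hpt : Tendsto (fun x => (ι x, n x)) (𝓝 y) (𝓝 (c, c)) := by
    rw [← hpy]; exact hpair.continuousAt
  set Q := fderiv ℝ (fderiv ℝ μ) (c, c)
  set P := fderiv ℝ μ (c, c)
  have hQ : ∀ p q, Q p q = Q q p := fun p q => (hμ.isSymmSndFDerivAt (by simp)).eq p q
  have hP2 : ∀ v, P (0, v) = v := by
    intro v
    have h1 : HasFDerivAt (fun Y => μ (c, Y)) (P.comp (ContinuousLinearMap.inr ℝ E E)) c :=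
      HasFDerivAt.comp (f := fun Y => (c, Y)) c hμ1 (hasFDerivAt_prodMk_right c c)
    have h2 : HasFDerivAt (fun Y => μ (c, Y)) (ContinuousLinearMap.id ℝ E) c :=
      (hasFDerivAt_id c).congr_of_eventuallyEq hl
    simpa using congrArg (fun T => T v) (h1.unique h2)
  have hP1 : ∀ v, P (v, 0) = v := by
    intro v
    have h1 : HasFDerivAt (fun X => μ (X, c)) (P.comp (ContinuousLinearMap.inl ℝ E E)) c :=
      HasFDerivAt.comp (f := fun Y => (Y, c)) c hμ1 (hasFDerivAt_prodMk_left c c)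
    have h2 : HasFDerivAt (fun X => μ (X, c)) (ContinuousLinearMap.id ℝ E) c :=
      (hasFDerivAt_id c).congr_of_eventuallyEq hr
    simpa using congrArg (fun T => T v) (h1.unique h2)
  -- Differentiate `μ(ι x, n x) = c`, using that both partial derivatives of `μ` at `(c, c)` are the
  -- identity.
  have hι' : ∀ u, fderiv ℝ ι y u = - fderiv ℝ n y u := by
    intro u
    have h1 : HasFDerivAt (fun x => μ (ι x, n x)) (P.comp ((fderiv ℝ ι y).prod (fderiv ℝ n y))) y :=
      HasFDerivAt.comp (f := fun x => (ι x, n x)) y (by rw [hpy]; exact hμ1) hpair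
    have h2 : HasFDerivAt (fun x => μ (ι x, n x)) (0 : F →L[ℝ] E) y :=
      (hasFDerivAt_const c y).congr_of_eventuallyEq hinv
    have h3 : P (fderiv ℝ ι y u, fderiv ℝ n y u) = 0 := by
      simpa using congrArg (fun T => T u) (h1.unique h2)
    have h4 : (fderiv ℝ ι y u, fderiv ℝ n y u) = (fderiv ℝ ι y u, 0) + (0, fderiv ℝ n y u) := by
      simp
    rw [h4, map_add, hP1, hP2] at h3
    exact eq_neg_of_add_eq_zero_left h3
  have hβ : ∀ v w, β v w = Q (v, 0) (0, w) := by
    intro v w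
    have hin : Tendsto (fun X : E => (X, c)) (𝓝 c) (𝓝 (c, c)) :=
      (hasFDerivAt_prodMk_left c c).continuousAt (𝕜 := ℝ)
    have he : (fun X => fderiv ℝ (fun Y => μ (X, Y)) c w) =ᶠ[𝓝 c]
        fun X => fderiv ℝ μ (X, c) (0, w) := by
      filter_upwards [hin.eventually hμe] with X hX
      have h1 : HasFDerivAt (fun Y => μ (X, Y))
          ((fderiv ℝ μ (X, c)).comp (ContinuousLinearMap.inr ℝ E E)) c :=
        HasFDerivAt.comp (f := fun Y => (X, Y)) c hX.hasFDerivAt (hasFDerivAt_prodMk_right X c)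
      rw [h1.fderiv]; rfl
    have h2 : HasFDerivAt (fun X => fderiv ℝ μ (X, c)) (Q.comp (ContinuousLinearMap.inl ℝ E E)) c :=
      HasFDerivAt.comp (f := fun Y => (Y, c)) c hμ2 (hasFDerivAt_prodMk_left c c)
    have h3 := (h2.clm_apply (hasFDerivAt_const ((0, w) : E × E) c)).congr_of_eventuallyEq he
    change fderiv ℝ (fun X => fderiv ℝ (fun Y => μ (X, Y)) c w) c v = _
    rw [h3.fderiv]
    simp
  -- The differentiation in `z` sees only the second slot of `μ`; the first slot stays frozen at `ι
  -- x`.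
  have hη : η =ᶠ[𝓝 y] fun x => (fderiv ℝ μ (ι x, n x)).comp
      ((ContinuousLinearMap.inr ℝ E E).comp (fderiv ℝ n x)) := by
    filter_upwards [hpt.eventually hμe, hne] with x hx hnx
    have h1 : HasFDerivAt (fun z => (ι x, n z))
        ((ContinuousLinearMap.inr ℝ E E).comp (fderiv ℝ n x)) x :=
      HasFDerivAt.comp x (hasFDerivAt_prodMk_right (ι x) (n x)) hnx.hasFDerivAt
    exact (HasFDerivAt.comp (f := fun z => (ι x, n z)) x hx.hasFDerivAt h1).fderiv
  have hD1 : HasFDerivAt (fun x => fderiv ℝ μ (ι x, n x))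
      (Q.comp ((fderiv ℝ ι y).prod (fderiv ℝ n y))) y :=
    HasFDerivAt.comp (f := fun x => (ι x, n x)) y (by rw [hpy]; exact hμ2) hpair
  have hD2 := (hD1.clm_comp ((hasFDerivAt_const (ContinuousLinearMap.inr ℝ E E) y).clm_comp hn2))
  have hD := hD2.congr_of_eventuallyEq hη
  refine ⟨hD.differentiableAt, ?_, ?_⟩
  · rw [hη.self_of_nhds]
    ext v
    simp [hpy, P, hP2]
  · intro u v
    have hval : ∀ u v, fderiv ℝ η y u v = Q (- fderiv ℝ n y u, fderiv ℝ n y u) (0, fderiv ℝ n y v) +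
        fderiv ℝ (fderiv ℝ n) y u v := by
      intro u v
      rw [hD.fderiv]
      simp [hpy, hι', hP2, P, add_comm]
    have hns : fderiv ℝ (fderiv ℝ n) y u v = fderiv ℝ (fderiv ℝ n) y v u :=
      (hn.isSymmSndFDerivAt (by simp)).eq u v
    -- The part of `Q` with both arguments in the second slot is symmetric, as is the second
    -- derivative of `n`. Both cancel on antisymmetrizing, which leaves only the mixed part `β`.
    have hsplit : ∀ a b : E, Q (-a, a) (0, b) = - Q (a, 0) (0, b) + Q (0, a) (0, b) := by
      intro a b
      have : (-a, a) = -((a, 0) : E × E) + (0, a) := by simp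
      rw [this, map_add, map_neg]; rfl
    rw [hval, hval, hns, hβ, hβ, hsplit, hsplit, hQ (0, fderiv ℝ n y u) (0, fderiv ℝ n y v)]
    abel

end Flat

/-! ### Derivatives of maps between manifolds, read in the model spaces. -/

section Tangent

variable {E : Type*} [NormedAddCommGroup E] [NormedSpace ℝ E]
  {F : Type*} [NormedAddCommGroup F] [NormedSpace ℝ F]
  {K : Type*} [NormedAddCommGroup K] [NormedSpace ℝ K]
  {M : Type*} [TopologicalSpace M] [ChartedSpace E M]
  {N : Type*} [TopologicalSpace N] [ChartedSpace F N]
  {P : Type*} [TopologicalSpace P] [ChartedSpace K P]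

variable (E F) in
/-- Smoothness at a point of a map between manifolds modelled on `E` and `F`. -/
abbrev SmoothAt (f : M → N) (x : M) : Prop := ContMDiffAt 𝓘(ℝ, E) 𝓘(ℝ, F) ∞ f x

variable (E F) in
/-- The derivative of a map between manifolds modelled on `E` and `F`, as a map of the model
spaces. -/
def modelDeriv (f : M → N) (x : M) : E →L[ℝ] F := mfderiv 𝓘(ℝ, E) 𝓘(ℝ, F) f x

theorem modelDeriv_comp_of_mdifferentiableAt {g : N → P} {f : M → N} {x : M} {y : N} (hy : f x = y)
    (hg : MDifferentiableAt 𝓘(ℝ, F) 𝓘(ℝ, K) g y) (hf : MDifferentiableAt 𝓘(ℝ, E) 𝓘(ℝ, F) f x) :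
    modelDeriv E K (fun z => g (f z)) x = (modelDeriv F K g y).comp (modelDeriv E F f x) := by
  subst hy
  exact (HasMFDerivAt.comp x hg.hasMFDerivAt hf.hasMFDerivAt).mfderiv

theorem SmoothAt.mdifferentiableAt {f : M → N} {x : M} (hf : SmoothAt E F f x) :
    MDifferentiableAt 𝓘(ℝ, E) 𝓘(ℝ, F) f x :=
  ContMDiffAt.mdifferentiableAt hf (by simp)

theorem modelDeriv_comp {g : N → P} {f : M → N} {x : M} {y : N} (hy : f x = y)
    (hg : SmoothAt F K g y) (hf : SmoothAt E F f x) :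
    modelDeriv E K (fun z => g (f z)) x = (modelDeriv F K g y).comp (modelDeriv E F f x) :=
  modelDeriv_comp_of_mdifferentiableAt hy hg.mdifferentiableAt hf.mdifferentiableAt

theorem SmoothAt.comp_of_eq {g : N → P} {f : M → N} {x : M} {y : N} (hy : f x = y)
    (hg : SmoothAt F K g y) (hf : SmoothAt E F f x) : SmoothAt E K (fun z => g (f z)) x := by
  subst hy
  exact ContMDiffAt.comp x hg hf

theorem modelDeriv_congr {f g : M → N} {x : M} (h : f =ᶠ[𝓝 x] g) :
    modelDeriv E F f x = modelDeriv E F g x := h.mfderiv_eq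

theorem modelDeriv_id (x : M) : modelDeriv E E (fun z : M => z) x = ContinuousLinearMap.id ℝ E :=
  mfderiv_id

theorem modelDeriv_const (x : M) (y : N) : modelDeriv E F (fun _ : M => y) x = 0 :=
  mfderiv_const

theorem modelDeriv_eq_fderiv (f : E → F) (x : E) : modelDeriv E F f x = fderiv ℝ f x :=
  mfderiv_eq_fderiv

theorem smoothAt_extChartAt [IsManifold 𝓘(ℝ, E) ∞ M] {p x : M}
    (hx : x ∈ (extChartAt 𝓘(ℝ, E) p).source) : SmoothAt E E (extChartAt 𝓘(ℝ, E) p) x :=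
  contMDiffAt_extChartAt' (by rwa [extChartAt_source] at hx)

theorem smoothAt_extChartAt_symm [IsManifold 𝓘(ℝ, E) ∞ M] {p : M} {y : E}
    (hy : y ∈ (extChartAt 𝓘(ℝ, E) p).target) : SmoothAt E E (extChartAt 𝓘(ℝ, E) p).symm y :=
  (contMDiffOn_extChartAt_symm p).contMDiffAt (extChartAt_target_mem_nhds' hy)

theorem modelDeriv_extChartAt [IsManifold 𝓘(ℝ, E) ∞ M] (p : M) :
    modelDeriv E E (extChartAt 𝓘(ℝ, E) p) p = ContinuousLinearMap.id ℝ E := by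
  have : IsManifold 𝓘(ℝ, E) 1 M := IsManifold.of_le (n := ∞) (by simp)
  exact mfderiv_extChartAt_self

theorem modelDeriv_extChartAt_comp_symm [IsManifold 𝓘(ℝ, E) ∞ M] {p : M} {y : E}
    (hy : y ∈ (extChartAt 𝓘(ℝ, E) p).target) :
    (modelDeriv E E (extChartAt 𝓘(ℝ, E) p) ((extChartAt 𝓘(ℝ, E) p).symm y)).comp
      (modelDeriv E E (extChartAt 𝓘(ℝ, E) p).symm y) = ContinuousLinearMap.id ℝ E := by
  rw [← modelDeriv_comp rfl (smoothAt_extChartAt ((extChartAt 𝓘(ℝ, E) p).map_target hy))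
    (smoothAt_extChartAt_symm hy), ← modelDeriv_id y]
  apply modelDeriv_congr
  filter_upwards [extChartAt_target_mem_nhds' hy] with z hz
  exact (extChartAt 𝓘(ℝ, E) p).right_inv hz

theorem modelDeriv_extChartAt_symm_comp [IsManifold 𝓘(ℝ, E) ∞ M] {p x : M}
    (hx : x ∈ (extChartAt 𝓘(ℝ, E) p).source) :
    (modelDeriv E E (extChartAt 𝓘(ℝ, E) p).symm (extChartAt 𝓘(ℝ, E) p x)).comp
      (modelDeriv E E (extChartAt 𝓘(ℝ, E) p) x) = ContinuousLinearMap.id ℝ E := by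
  rw [← modelDeriv_comp rfl (smoothAt_extChartAt_symm ((extChartAt 𝓘(ℝ, E) p).map_source hx))
    (smoothAt_extChartAt hx), ← modelDeriv_id x]
  apply modelDeriv_congr
  filter_upwards [extChartAt_source_mem_nhds' hx] with z hz
  exact (extChartAt 𝓘(ℝ, E) p).left_inv hz

theorem modelDeriv_extChartAt_symm [IsManifold 𝓘(ℝ, E) ∞ M] (p : M) :
    modelDeriv E E (extChartAt 𝓘(ℝ, E) p).symm (extChartAt 𝓘(ℝ, E) p p) =
      ContinuousLinearMap.id ℝ E := by
  have := modelDeriv_extChartAt_symm_comp (mem_extChartAt_source (I := 𝓘(ℝ, E)) p)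
  rwa [modelDeriv_extChartAt, ContinuousLinearMap.comp_id] at this

theorem smoothAt_iff_contDiffAt {f : E → F} {x : E} : SmoothAt E F f x ↔ ContDiffAt ℝ ∞ f x :=
  contMDiffAt_iff_contDiffAt

theorem SmoothAt.eventually_mdifferentiableAt [IsManifold 𝓘(ℝ, E) ∞ M] [IsManifold 𝓘(ℝ, F) ∞ N]
    {f : M → N} {x : M} (hf : SmoothAt E F f x) :
    ∀ᶠ z in 𝓝 x, MDifferentiableAt 𝓘(ℝ, E) 𝓘(ℝ, F) f z := by
  have : IsManifold 𝓘(ℝ, E) 1 M := IsManifold.of_le (n := ∞) (by simp)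
  have : IsManifold 𝓘(ℝ, F) 1 N := IsManifold.of_le (n := ∞) (by simp)
  have h1 : ContMDiffAt 𝓘(ℝ, E) 𝓘(ℝ, F) 1 f x := ContMDiffAt.of_le hf (by simp)
  filter_upwards [(contMDiffAt_iff_contMDiffAt_nhds (by simp)).1 h1] with z hz using
    hz.mdifferentiableAt (by simp)

end Tangent

/-! ### The Lie bracket as the antisymmetrized second derivative of the group law. -/

section LieGroup

variable {E : Type*} [NormedAddCommGroup E] [NormedSpace ℝ E]
  {K : Type*} [NormedAddCommGroup K] [NormedSpace ℝ K] {P : Type*} [TopologicalSpace P]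
  [ChartedSpace K P]
  {G : Type*} [TopologicalSpace G] [ChartedSpace E G] [Group G]

variable (E G) in
/-- The group law in the preferred chart at the identity. -/
def chartMul (p : E × E) : E :=
  extChartAt 𝓘(ℝ, E) (1 : G) ((extChartAt 𝓘(ℝ, E) (1 : G)).symm p.1 *
    (extChartAt 𝓘(ℝ, E) (1 : G)).symm p.2)

theorem chartMul_left : ∀ᶠ Y in 𝓝 (extChartAt 𝓘(ℝ, E) (1 : G) 1),
    chartMul E G (extChartAt 𝓘(ℝ, E) (1 : G) 1, Y) = Y := by
  filter_upwards [extChartAt_target_mem_nhds (I := 𝓘(ℝ, E)) (1 : G)] with Y hY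
  rw [chartMul, extChartAt_to_inv (I := 𝓘(ℝ, E)) (1 : G), one_mul,
    (extChartAt 𝓘(ℝ, E) (1 : G)).right_inv hY]

theorem chartMul_right : ∀ᶠ X in 𝓝 (extChartAt 𝓘(ℝ, E) (1 : G) 1),
    chartMul E G (X, extChartAt 𝓘(ℝ, E) (1 : G) 1) = X := by
  filter_upwards [extChartAt_target_mem_nhds (I := 𝓘(ℝ, E)) (1 : G)] with Y hY
  rw [chartMul, extChartAt_to_inv (I := 𝓘(ℝ, E)) (1 : G), mul_one,
    (extChartAt 𝓘(ℝ, E) (1 : G)).right_inv hY]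

variable [LieGroup 𝓘(ℝ, E) ∞ G]

theorem smoothAt_mul_left (a x : G) : SmoothAt E E (fun z : G => a * z) x :=
  contMDiff_mul_left.contMDiffAt

theorem SmoothAt.mul {f g : P → G} {x : P} (hf : SmoothAt K E f x) (hg : SmoothAt K E g x) :
    SmoothAt K E (fun z => f z * g z) x :=
  ContMDiffAt.mul hf hg

theorem SmoothAt.inv {f : P → G} {x : P} (hf : SmoothAt K E f x) :
    SmoothAt K E (fun z => (f z)⁻¹) x :=
  ContMDiffAt.inv hf

theorem contDiffAt_chartMul : ContDiffAt ℝ ∞ (chartMul E G)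
    (extChartAt 𝓘(ℝ, E) (1 : G) 1, extChartAt 𝓘(ℝ, E) (1 : G) 1) := by
  rw [← smoothAt_iff_contDiffAt]
  have hs : SmoothAt E E (extChartAt 𝓘(ℝ, E) (1 : G)).symm (extChartAt 𝓘(ℝ, E) (1 : G) 1) :=
    smoothAt_extChartAt_symm (mem_extChartAt_target (I := 𝓘(ℝ, E)) (1 : G))
  have h1 : SmoothAt (E × E) E (fun p : E × E => (extChartAt 𝓘(ℝ, E) (1 : G)).symm p.1)
      (extChartAt 𝓘(ℝ, E) (1 : G) 1, extChartAt 𝓘(ℝ, E) (1 : G) 1) :=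
    hs.comp_of_eq rfl (smoothAt_iff_contDiffAt.2 contDiffAt_fst)
  have h2 : SmoothAt (E × E) E (fun p : E × E => (extChartAt 𝓘(ℝ, E) (1 : G)).symm p.2)
      (extChartAt 𝓘(ℝ, E) (1 : G) 1, extChartAt 𝓘(ℝ, E) (1 : G) 1) :=
    hs.comp_of_eq rfl (smoothAt_iff_contDiffAt.2 contDiffAt_snd)
  exact (smoothAt_extChartAt (mem_extChartAt_source (1 : G))).comp_of_eq
    (f := fun p : E × E => (extChartAt 𝓘(ℝ, E) (1 : G)).symm p.1 *
      (extChartAt 𝓘(ℝ, E) (1 : G)).symm p.2)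
    (by rw [extChartAt_to_inv (I := 𝓘(ℝ, E)) (1 : G), mul_one]) (h1.mul h2)

/-- A left invariant vector field in the preferred chart at the identity. -/
theorem mpullbackWithin_mulInvariantVectorField (v : GroupLieAlgebra 𝓘(ℝ, E) G) :
    (VectorField.mpullbackWithin 𝓘(ℝ, E) 𝓘(ℝ, E) (extChartAt 𝓘(ℝ, E) (1 : G)).symm
      (mulInvariantVectorField v) (Set.range 𝓘(ℝ, E)) : E → E)
      =ᶠ[𝓝 (extChartAt 𝓘(ℝ, E) (1 : G) 1)]
    fun X => fderiv ℝ (fun Y => chartMul E G (X, Y)) (extChartAt 𝓘(ℝ, E) (1 : G) 1) v := by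
  filter_upwards [extChartAt_target_mem_nhds (I := 𝓘(ℝ, E)) (1 : G)] with X hX
  set e := extChartAt 𝓘(ℝ, E) (1 : G)
  have hinv : (modelDeriv E E e.symm X).inverse = modelDeriv E E e (e.symm X) := by
    refine ContinuousLinearMap.inverse_eq ?_ (modelDeriv_extChartAt_comp_symm hX)
    have := modelDeriv_extChartAt_symm_comp (E := E) (e.map_target hX)
    rwa [e.right_inv hX] at this
  have h1 : (modelDeriv E E e.symm X).inverse (modelDeriv E E (fun z => e.symm X * z) 1 v) =
      fderiv ℝ (fun Y => chartMul E G (X, Y)) (e 1) v := by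
    have hsm : SmoothAt E E e.symm (e 1) :=
      smoothAt_extChartAt_symm (mem_extChartAt_target (I := 𝓘(ℝ, E)) (1 : G))
    have hm : SmoothAt E E (fun Y => e.symm X * e.symm Y) (e 1) :=
      (smoothAt_mul_left (e.symm X) 1).comp_of_eq (extChartAt_to_inv (I := 𝓘(ℝ, E)) (1 : G)) hsm
    have h2 : modelDeriv E E (fun Y => chartMul E G (X, Y)) (e 1) =
        (modelDeriv E E e (e.symm X)).comp (modelDeriv E E (fun z => e.symm X * z) 1) := by
      have hy : e.symm X * e.symm (e 1) = e.symm X := by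
        rw [extChartAt_to_inv (I := 𝓘(ℝ, E)) (1 : G), mul_one]
      have h3 := modelDeriv_comp (f := fun Y => e.symm X * e.symm Y) hy
        (smoothAt_extChartAt (E := E) (e.map_target hX)) hm
      have h4 := modelDeriv_comp (g := fun z => e.symm X * z)
        (extChartAt_to_inv (I := 𝓘(ℝ, E)) (1 : G)) (smoothAt_mul_left (e.symm X) 1) hsm
      rw [modelDeriv_extChartAt_symm, ContinuousLinearMap.comp_id] at h4
      rw [h4] at h3
      exact h3
    rw [hinv, ← modelDeriv_eq_fderiv, h2]
    rfl
  rw [← h1]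
  simp only [VectorField.mpullbackWithin, modelWithCornersSelf_coe, Set.range_id,
    mfderivWithin_univ]
  rfl

/-- In the chart, the left invariant field of `v` is `X ↦ ∂_Y μ(X, Y) v` at `Y = c`, with value `v`
at `c`. The formula is therefore `[V, W] = DW(V) - DV(W)` at `c`; the derivative of the preferred
chart at `1` is the identity and adds no factor. -/
theorem bracket_eq_chartMul (v w : GroupLieAlgebra 𝓘(ℝ, E) G) :
    ((⁅v, w⁆ : GroupLieAlgebra 𝓘(ℝ, E) G) : E) =
      fderiv ℝ (fun X => fderiv ℝ (fun Y => chartMul E G (X, Y)) (extChartAt 𝓘(ℝ, E) (1 : G) 1) w)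
        (extChartAt 𝓘(ℝ, E) (1 : G) 1) v -
      fderiv ℝ (fun X => fderiv ℝ (fun Y => chartMul E G (X, Y)) (extChartAt 𝓘(ℝ, E) (1 : G) 1) v)
        (extChartAt 𝓘(ℝ, E) (1 : G) 1) w := by
  have hval : ∀ v : E, fderiv ℝ (fun Y => chartMul E G (extChartAt 𝓘(ℝ, E) (1 : G) 1, Y))
      (extChartAt 𝓘(ℝ, E) (1 : G) 1) v = v := by
    intro v
    have := ((hasFDerivAt_id (𝕜 := ℝ) _).congr_of_eventuallyEq
      (chartMul_left (E := E) (G := G))).fderiv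
    rw [this]; rfl
  -- The bracket depends only on the germs of the two fields, so the chart formulas near `c`
  -- suffice.
  have key : ∀ (v w : E) (V W : E → E),
      V =ᶠ[𝓝 (extChartAt 𝓘(ℝ, E) (1 : G) 1)]
        (fun X => fderiv ℝ (fun Y => chartMul E G (X, Y)) (extChartAt 𝓘(ℝ, E) (1 : G) 1) v) →
      W =ᶠ[𝓝 (extChartAt 𝓘(ℝ, E) (1 : G) 1)]
        (fun X => fderiv ℝ (fun Y => chartMul E G (X, Y)) (extChartAt 𝓘(ℝ, E) (1 : G) 1) w) →
      (modelDeriv E E (extChartAt 𝓘(ℝ, E) (1 : G)) 1).inverse (VectorField.lieBracketWithin ℝ V W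
        ((extChartAt 𝓘(ℝ, E) (1 : G)).symm ⁻¹' Set.univ ∩ Set.range 𝓘(ℝ, E))
        (extChartAt 𝓘(ℝ, E) (1 : G) 1)) =
      fderiv ℝ (fun X => fderiv ℝ (fun Y => chartMul E G (X, Y)) (extChartAt 𝓘(ℝ, E) (1 : G) 1) w)
        (extChartAt 𝓘(ℝ, E) (1 : G) 1) v -
      fderiv ℝ (fun X => fderiv ℝ (fun Y => chartMul E G (X, Y)) (extChartAt 𝓘(ℝ, E) (1 : G) 1) v)
        (extChartAt 𝓘(ℝ, E) (1 : G) 1) w := by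
    intro v w V W hV hW
    have hu : (extChartAt 𝓘(ℝ, E) (1 : G)).symm ⁻¹' Set.univ ∩ Set.range 𝓘(ℝ, E) = Set.univ := by
      simp
    rw [modelDeriv_extChartAt, ContinuousLinearMap.inverse_id, hu,
      VectorField.lieBracketWithin_univ, hV.lieBracket_vectorField_eq hW]
    simp only [ContinuousLinearMap.id_apply, VectorField.lieBracket_eq]
    rw [hval, hval]
  exact key v w _ _ (mpullbackWithin_mulInvariantVectorField v)
    (mpullbackWithin_mulInvariantVectorField w)

end LieGroup

/-! ### Local sections and fibre curves of a submersion. -/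

section Submersion

universe u

variable {E : Type u} [NormedAddCommGroup E] [NormedSpace ℝ E]
  {F : Type*} [NormedAddCommGroup F] [NormedSpace ℝ F]
  {M : Type*} [TopologicalSpace M] [ChartedSpace E M]
  {N : Type*} [TopologicalSpace N] [ChartedSpace F N]

/-- The normal form of a submersion. -/
theorem Manifold.IsSubmersionAt.exists_normalForm {f : M → N} {x : M}
    (hf : Manifold.IsSubmersionAt 𝓘(ℝ, E) 𝓘(ℝ, F) ∞ f x) :
    ∃ (C : Type u) (_ : NormedAddCommGroup C) (_ : NormedSpace ℝ C) (e : E ≃L[ℝ] F × C)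
      (d : PartialEquiv M E) (c : PartialEquiv N F),
      d.source ∈ 𝓝 x ∧ c.source ∈ 𝓝 (f x) ∧ d.target ∈ 𝓝 (d x) ∧
      SmoothAt E E d x ∧ SmoothAt E E d.symm (d x) ∧ SmoothAt F F c (f x) ∧
      Set.MapsTo f d.source c.source ∧ ∀ y ∈ d.target, c (f (d.symm y)) = (e y).1 := by
  refine ⟨hf.complement, inferInstance, inferInstance, hf.equiv, hf.domChart.extend 𝓘(ℝ, E),
    hf.codChart.extend 𝓘(ℝ, F), ?_, ?_, ?_, ?_, ?_, ?_, ?_, ?_⟩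
  · rw [OpenPartialHomeomorph.extend_source]
    exact hf.domChart.open_source.mem_nhds hf.mem_domChart_source
  · rw [OpenPartialHomeomorph.extend_source]
    exact hf.codChart.open_source.mem_nhds hf.mem_codChart_source
  · refine hf.domChart.isOpen_extend_target.mem_nhds (PartialEquiv.map_source _ ?_)
    rw [OpenPartialHomeomorph.extend_source]
    exact hf.mem_domChart_source
  · exact hf.domChart.contMDiffAt_extend hf.domChart_mem_maximalAtlas hf.mem_domChart_source
  · refine (contMDiffOn_extend_symm hf.domChart_mem_maximalAtlas).contMDiffAt ?_
    rw [modelWithCornersSelf_coe, Set.image_id]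
    exact hf.domChart.open_target.mem_nhds (hf.domChart.map_source hf.mem_domChart_source)
  · exact hf.codChart.contMDiffAt_extend hf.codChart_mem_maximalAtlas hf.mem_codChart_source
  · rw [OpenPartialHomeomorph.extend_source, OpenPartialHomeomorph.extend_source]
    exact hf.source_subset_preimage_source
  · exact fun y hy => hf.writtenInCharts hy

/-- In the normal form `f` is the projection `F × C → F`; the section freezes the `C`-coordinate at
its value at `x`. -/
theorem Manifold.IsSubmersionAt.exists_local_section {f : M → N} {x : M}
    (hf : Manifold.IsSubmersionAt 𝓘(ℝ, E) 𝓘(ℝ, F) ∞ f x) :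
    ∃ σ : N → M, σ (f x) = x ∧ SmoothAt F E σ (f x) ∧ ∀ᶠ q in 𝓝 (f x), f (σ q) = q := by
  obtain ⟨C, _, _, e, d, c, hds, hcs, hdt, hd, hd', hc, hmaps, hloc⟩ := hf.exists_normalForm
  have hx : d.symm (d x) = x := d.left_inv (mem_of_mem_nhds hds)
  have h0 : e.symm (c (f x), (e (d x)).2) = d x := by
    have := hloc (d x) (mem_of_mem_nhds hdt)
    rw [hx] at this
    rw [this]
    simp
  have hsm : SmoothAt F E (fun q => e.symm (c q, (e (d x)).2)) (f x) := by
    refine SmoothAt.comp_of_eq (g := fun y : F => e.symm (y, (e (d x)).2)) rfl ?_ hc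
    rw [smoothAt_iff_contDiffAt]
    fun_prop
  refine ⟨fun q => d.symm (e.symm (c q, (e (d x)).2)), ?_, hd'.comp_of_eq h0 hsm, ?_⟩
  · change d.symm (e.symm (c (f x), (e (d x)).2)) = x
    rw [h0, hx]
  · have ht := hsm.continuousAt.tendsto
    rw [h0] at ht
    filter_upwards [ht.eventually hdt, hcs] with q hq hqc
    refine c.injOn (hmaps (d.map_target hq)) hqc ?_
    rw [hloc _ hq]
    simp

theorem Manifold.IsSubmersionAt.surjective_modelDeriv {f : M → N} {x : M}
    (hf : Manifold.IsSubmersionAt 𝓘(ℝ, E) 𝓘(ℝ, F) ∞ f x) :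
    Function.Surjective (modelDeriv E F f x) := by
  obtain ⟨σ, hσx, hσ, hfσ⟩ := hf.exists_local_section
  have h := modelDeriv_comp hσx (show SmoothAt E F f x from hf.contMDiffAt) hσ
  rw [modelDeriv_congr hfσ, modelDeriv_id] at h
  exact fun w => ⟨modelDeriv F E σ (f x) w, (congrArg (fun T => T w) h).symm⟩

/-- The curve is a straight line in the normal-form chart. Its direction has zero `F`-component
because `v` is in the kernel, so `f` is constant along it. -/
theorem Manifold.IsSubmersionAt.exists_curve_in_fiber {f : M → N} {x : M}
    (hf : Manifold.IsSubmersionAt 𝓘(ℝ, E) 𝓘(ℝ, F) ∞ f x) {v : E}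
    (hv : modelDeriv E F f x v = 0) :
    ∃ γ : ℝ → M, γ 0 = x ∧ SmoothAt ℝ E γ 0 ∧ modelDeriv ℝ E γ 0 1 = v ∧
      ∀ᶠ t in 𝓝 0, f (γ t) = f x := by
  obtain ⟨C, _, _, e, d, c, hds, hcs, hdt, hd, hd', hc, hmaps, hloc⟩ := hf.exists_normalForm
  have hx : d.symm (d x) = x := d.left_inv (mem_of_mem_nhds hds)
  set D := modelDeriv E E d x
  have hDv : (e (D v)).1 = 0 := by
    have h1 := modelDeriv_comp rfl hc (show SmoothAt E F f x from hf.contMDiffAt)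
    let l : E →L[ℝ] F := (ContinuousLinearMap.fst ℝ F C).comp (e : E →L[ℝ] F × C)
    have h2 := modelDeriv_comp (g := l) rfl (smoothAt_iff_contDiffAt.2 l.contDiff.contDiffAt) hd
    have h3 : (fun z => c (f z)) =ᶠ[𝓝 x] fun z => l (d z) := by
      filter_upwards [hds] with z hz
      have := hloc (d z) (d.map_source hz)
      rwa [d.left_inv hz] at this
    rw [modelDeriv_congr h3, h2, modelDeriv_eq_fderiv, l.fderiv] at h1
    have h4 := congrArg (fun T => T v) h1
    simp only [ContinuousLinearMap.comp_apply, hv, map_zero] at h4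
    exact h4
  have hlin : SmoothAt ℝ E (fun t : ℝ => d x + t • D v) 0 := by
    rw [smoothAt_iff_contDiffAt]
    fun_prop
  have h0 : d x + (0 : ℝ) • D v = d x := by simp
  refine ⟨fun t => d.symm (d x + t • D v), ?_, hd'.comp_of_eq h0 hlin, ?_, ?_⟩
  · change d.symm (d x + (0 : ℝ) • D v) = x
    rw [h0, hx]
  · rw [modelDeriv_comp (f := fun t : ℝ => d x + t • D v) h0 hd' hlin, modelDeriv_eq_fderiv]
    have h5 : fderiv ℝ (fun t : ℝ => d x + t • D v) 0 1 = D v := by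
      have : HasFDerivAt (fun t : ℝ => d x + t • D v)
          ((ContinuousLinearMap.id ℝ ℝ).smulRight (D v)) 0 :=
        ((hasFDerivAt_id (0 : ℝ)).smul_const (D v)).const_add _
      rw [this.fderiv]
      simp
    have h6 := modelDeriv_comp (g := d.symm) rfl hd' hd
    have h7 : (fun z => d.symm (d z)) =ᶠ[𝓝 x] fun z => z := by
      filter_upwards [hds] with z hz using d.left_inv hz
    rw [modelDeriv_congr h7, modelDeriv_id] at h6
    rw [ContinuousLinearMap.comp_apply, h5]
    exact (congrArg (fun T => T v) h6).symm
  · have ht := hlin.continuousAt.tendsto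
    rw [h0] at ht
    filter_upwards [ht.eventually hdt] with t ht
    refine c.injOn (hmaps (d.map_target ht)) (mem_of_mem_nhds hcs) ?_
    rw [hloc _ ht]
    have h1 := hloc (d x) (mem_of_mem_nhds hdt)
    rw [hx] at h1
    rw [h1, map_add, map_smul, Prod.fst_add, Prod.smul_fst, hDv, smul_zero, add_zero]

end Submersion

/-! ### Fixed points of the automorphism. -/

section Automorphism

variable {E : Type*} [NormedAddCommGroup E] [NormedSpace ℝ E]
  {G : Type*} [TopologicalSpace G] [ChartedSpace E G] [Group G]
  {s : MulAut G} {H : Subgroup G}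

theorem IsThreeSymmetricPair.apply_apply_apply (hs : IsThreeSymmetricPair (E := E) s H) (x : G) :
    s (s (s x)) = x := by
  have h := pow_orderOf_eq_one s
  rw [hs.order] at h
  exact DFunLike.congr_fun h x

theorem IsThreeSymmetricPair.smoothAt (hs : IsThreeSymmetricPair (E := E) s H) (x : G) :
    SmoothAt E E s x := hs.smooth.contMDiffAt

theorem mem_mPart_iff {X : E} : (X : GroupLieAlgebra 𝓘(ℝ, E) G) ∈ mPart (E := E) s ↔
    modelDeriv E E s 1 (modelDeriv E E s 1 X) + modelDeriv E E s 1 X + X = 0 := Iff.rfl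

theorem IsThreeSymmetricPair.deriv_cube (hs : IsThreeSymmetricPair (E := E) s H) (X : E) :
    modelDeriv E E s 1 (modelDeriv E E s 1 (modelDeriv E E s 1 X)) = X := by
  have h2 := modelDeriv_comp (map_one s) (hs.smoothAt 1) (hs.smoothAt 1)
  have h3 := modelDeriv_comp (f := fun z => s (s z)) (by simp) (hs.smoothAt 1)
    ((hs.smoothAt 1).comp_of_eq (map_one s) (hs.smoothAt 1))
  rw [h2] at h3
  simp only [hs.apply_apply_apply] at h3
  rw [modelDeriv_id] at h3
  exact (congrArg (fun T => T X) h3).symm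

/-- A fixed vector of the differential of `s` is the velocity of a curve of fixed points: in the
chart obtained by averaging the preferred one, `s` is linear. -/
theorem IsThreeSymmetricPair.exists_fixed_curve [LieGroup 𝓘(ℝ, E) ∞ G] [CompleteSpace E]
    (hs : IsThreeSymmetricPair (E := E) s H) {X : E} (hX : modelDeriv E E s 1 X = X) :
    ∃ γ : ℝ → G, γ 0 = 1 ∧ SmoothAt ℝ E γ 0 ∧ modelDeriv ℝ E γ 0 1 = X ∧
      ∀ᶠ t in 𝓝 0, s (γ t) = γ t := by
  set S := modelDeriv E E s 1
  set e := extChartAt 𝓘(ℝ, E) (1 : G) with he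
  have hsc : ∀ Y, S (S (S Y)) = Y := hs.deriv_cube
  -- This is the average of `S⁻ᵏ ∘ e ∘ sᵏ` over `k = 0, 1, 2`, written with `S⁻¹ = S²` and `S⁻² =
  -- S`. It intertwines `s` with `S`.
  let χ : G → E := fun g => (1 / 3 : ℝ) • (e g + S (S (e (s g))) + S (e (s (s g))))
  have hχs : ∀ g, χ (s g) = S (χ g) := by
    intro g
    simp only [χ, map_smul, map_add, hs.apply_apply_apply, hsc]
    congr 1
    abel
  have hes : SmoothAt E E e 1 := smoothAt_extChartAt (mem_extChartAt_source (1 : G))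
  have he' : e.symm (e 1) = 1 := extChartAt_to_inv (I := 𝓘(ℝ, E)) (1 : G)
  have hesy : SmoothAt E E e.symm (e 1) :=
    smoothAt_extChartAt_symm (mem_extChartAt_target (I := 𝓘(ℝ, E)) (1 : G))
  have hss : SmoothAt E E (fun g => s (s g)) 1 :=
    (hs.smoothAt 1).comp_of_eq (map_one s) (hs.smoothAt 1)
  have hs1 : SmoothAt E E (fun g => e (s g)) 1 := hes.comp_of_eq (map_one s) (hs.smoothAt 1)
  have hs2 : SmoothAt E E (fun g => e (s (s g))) 1 := hes.comp_of_eq (by simp) hss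
  have hd1 : modelDeriv E E (fun g => e (s g)) 1 = S := by
    rw [modelDeriv_comp (map_one s) hes (hs.smoothAt 1), he, modelDeriv_extChartAt]; rfl
  have hd2 : modelDeriv E E (fun g => e (s (s g))) 1 = S.comp S := by
    rw [modelDeriv_comp (f := fun g => s (s g)) (by simp) hes hss,
      modelDeriv_comp (map_one s) (hs.smoothAt 1) (hs.smoothAt 1), he, modelDeriv_extChartAt]; rfl
  have hd0 : modelDeriv E E e 1 = ContinuousLinearMap.id ℝ E := modelDeriv_extChartAt 1
  have hflat : ∀ {k : G → E} {T : E →L[ℝ] E}, SmoothAt E E k 1 → modelDeriv E E k 1 = T →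
      ContDiffAt ℝ ∞ (fun y => k (e.symm y)) (e 1) ∧
      HasFDerivAt (fun y => k (e.symm y)) T (e 1) := by
    intro k T hk hT
    have h1 : SmoothAt E E (fun y => k (e.symm y)) (e 1) := hk.comp_of_eq he' hesy
    have h2 := modelDeriv_comp he' hk hesy
    rw [modelDeriv_eq_fderiv, hT, he, modelDeriv_extChartAt_symm, ContinuousLinearMap.comp_id] at h2
    rw [smoothAt_iff_contDiffAt] at h1
    refine ⟨h1, ?_⟩
    rw [← h2]
    exact (h1.differentiableAt (by simp)).hasFDerivAt
  obtain ⟨c0, f0⟩ := hflat hes hd0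
  obtain ⟨c1, f1⟩ := hflat hs1 hd1
  obtain ⟨c2, f2⟩ := hflat hs2 hd2
  let k : E → E := fun y => χ (e.symm y)
  have hkc : ContDiffAt ℝ ∞ k (e 1) :=
    ((c0.add (S.contDiff.contDiffAt.comp _ (S.contDiff.contDiffAt.comp _ c1))).add
      (S.contDiff.contDiffAt.comp _ c2)).const_smul (1 / 3 : ℝ)
  -- Each of the three terms has derivative `S⁻ᵏSᵏ = 1`, so `χ` is a chart near `1` by the inverse
  -- function theorem.
  have hkf : HasFDerivAt k ((ContinuousLinearEquiv.refl ℝ E : E ≃L[ℝ] E) : E →L[ℝ] E) (e 1) := by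
    have := ((f0.add (S.hasFDerivAt.comp _ (S.hasFDerivAt.comp _ f1))).add
      (S.hasFDerivAt.comp _ f2)).const_smul (1 / 3 : ℝ)
    refine this.congr_fderiv ?_
    ext Y
    simp only [add_apply, smul_apply, ContinuousLinearMap.comp_apply, hsc]
    simp
    module
  have hstrict := hkc.hasStrictFDerivAt' hkf (by simp)
  let ψ : E → E := hkc.localInverse hkf (by simp)
  have hψc : ContDiffAt ℝ ∞ ψ (k (e 1)) := hkc.to_localInverse hkf (by simp)
  have hψ1 : ψ (k (e 1)) = e 1 := hkc.localInverse_apply_image hkf (by simp)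
  have hψl : ∀ᶠ y in 𝓝 (e 1), ψ (k y) = y := hstrict.eventually_left_inverse
  have hψr : ∀ᶠ y in 𝓝 (k (e 1)), k (ψ y) = y := hstrict.eventually_right_inverse
  have hψf : HasFDerivAt ψ (ContinuousLinearMap.id ℝ E) (k (e 1)) :=
    hstrict.to_localInverse.hasFDerivAt
  have hχ1 : S (χ 1) = χ 1 := by rw [← hχs, map_one]
  have hk1 : k (e 1) = χ 1 := by simp only [k, he']
  -- The base point `χ 1` and the direction `X` are both fixed by `S`, hence so is the whole line.
  let l : ℝ → E := fun t => k (e 1) + t • X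
  have hl0 : l 0 = k (e 1) := by simp [l]
  have hlf : HasFDerivAt l ((ContinuousLinearMap.id ℝ ℝ).smulRight X) 0 :=
    ((hasFDerivAt_id (0 : ℝ)).smul_const X).const_add _
  have hlc : ContDiffAt ℝ ∞ l 0 := by fun_prop
  have hSl : ∀ t, S (l t) = l t := by
    intro t
    simp only [l, map_add, map_smul, hk1, hχ1, hX]
  have hψl0 : ψ (l 0) = e 1 := by rw [hl0, hψ1]
  have hψlc : ContDiffAt ℝ ∞ (fun t => ψ (l t)) 0 :=
    ContDiffAt.comp (f := l) 0 (by rwa [hl0]) hlc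
  have hγs : SmoothAt ℝ E (fun t => e.symm (ψ (l t))) 0 :=
    hesy.comp_of_eq hψl0 (smoothAt_iff_contDiffAt.2 hψlc)
  have hγ0 : e.symm (ψ (l 0)) = 1 := by rw [hψl0, he']
  refine ⟨fun t => e.symm (ψ (l t)), hγ0, hγs, ?_, ?_⟩
  · rw [modelDeriv_comp (f := fun t => ψ (l t)) hψl0 hesy (smoothAt_iff_contDiffAt.2 hψlc),
      modelDeriv_eq_fderiv, he, modelDeriv_extChartAt_symm]
    have : HasFDerivAt (fun t => ψ (l t)) _ 0 :=
      HasFDerivAt.comp (f := l) 0 (by rw [hl0]; exact hψf) hlf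
    rw [this.fderiv]
    simp
  · have htl : Tendsto l (𝓝 0) (𝓝 (k (e 1))) := by rw [← hl0]; exact hlc.continuousAt
    have hψt : Tendsto (fun t => ψ (l t)) (𝓝 0) (𝓝 (e 1)) := by
      rw [← hψl0]; exact hψlc.continuousAt
    have hγt : Tendsto (fun t => e.symm (ψ (l t))) (𝓝 0) (𝓝 1) := by
      have := hγs.continuousAt.tendsto
      rwa [hγ0] at this
    have hst : Tendsto (fun t => s (e.symm (ψ (l t)))) (𝓝 0) (𝓝 1) := by
      have := (hs.smoothAt 1).continuousAt.tendsto
      rw [map_one] at this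
      exact this.comp hγt
    have hsrc : e.source ∈ 𝓝 (1 : G) := extChartAt_source_mem_nhds (I := 𝓘(ℝ, E)) (1 : G)
    have het : Tendsto (fun t => e (s (e.symm (ψ (l t))))) (𝓝 0) (𝓝 (e 1)) :=
      hes.continuousAt.tendsto.comp hst
    filter_upwards [hγt.eventually hsrc, hst.eventually hsrc, het.eventually hψl,
      htl.eventually hψr, hψt.eventually (extChartAt_target_mem_nhds (I := 𝓘(ℝ, E)) (1 : G))]
      with t h1 h2 h3 h4 h5
    -- Both points have the same `χ`-coordinate `l t = S (l t)`, and `ψ` recovers the `e`-coordinate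
    -- from it.
    refine e.injOn h2 h1 ?_
    rw [← h3]
    have h6 : k (e (s (e.symm (ψ (l t))))) = l t := by
      change χ (e.symm (e (s (e.symm (ψ (l t)))))) = l t
      rw [e.left_inv h2, hχs]
      change S (k (ψ (l t))) = l t
      rw [h4, hSl]
    rw [h6, e.right_inv h5]

end Automorphism

/-! ### The tangent spaces of `G/H`, the invariant metric and invariant distributions. -/

section Quotient

variable {E : Type*} [NormedAddCommGroup E] [NormedSpace ℝ E]
  {G : Type*} [TopologicalSpace G] [ChartedSpace E G] [Group G]
  {s : MulAut G} {H : Subgroup G}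

/-- The projection `X ↦ X_𝔪` as an endomorphism of the model space. -/
def mProjection (E : Type*) [NormedAddCommGroup E] [NormedSpace ℝ E]
    {G : Type*} [TopologicalSpace G] [ChartedSpace E G] [Group G] (s : MulAut G) : E →L[ℝ] E :=
  -- With `S³ = 1`, the average `(1 + S + S²)/3` projects onto `𝔥`; this is its complement `1 - (1 +
  -- S + S²)/3`.
  (1 / 3 : ℝ) • ((2 : ℝ) • ContinuousLinearMap.id ℝ E - modelDeriv E E s 1 -
    (modelDeriv E E s 1).comp (modelDeriv E E s 1))

theorem mProjection_apply (X : E) : mProjection E s X =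
    (1 / 3 : ℝ) • ((2 : ℝ) • X - modelDeriv E E s 1 X -
      modelDeriv E E s 1 (modelDeriv E E s 1 X)) := rfl

theorem mProjection_of_mem {X : E} (hX : (X : GroupLieAlgebra 𝓘(ℝ, E) G) ∈ mPart (E := E) s) :
    mProjection E s X = X := by
  rw [mem_mPart_iff] at hX
  rw [mProjection_apply, ← sub_eq_zero]
  have h : (1 / 3 : ℝ) • ((2 : ℝ) • X - modelDeriv E E s 1 X -
      modelDeriv E E s 1 (modelDeriv E E s 1 X)) - X = (-1 / 3 : ℝ) •
      (modelDeriv E E s 1 (modelDeriv E E s 1 X) + modelDeriv E E s 1 X + X) := by module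
  rw [h, hX, smul_zero]

theorem IsThreeSymmetricPair.mProjection_mem (hs : IsThreeSymmetricPair (E := E) s H) (X : E) :
    (mProjection E s X : GroupLieAlgebra 𝓘(ℝ, E) G) ∈ mPart (E := E) s := by
  rw [mem_mPart_iff, mProjection_apply]
  simp only [map_smul, map_sub, hs.deriv_cube]
  module

theorem IsThreeSymmetricPair.sub_mProjection_mem (hs : IsThreeSymmetricPair (E := E) s H) (X : E) :
    modelDeriv E E s 1 (X - mProjection E s X) = X - mProjection E s X := by
  rw [mProjection_apply]
  simp only [map_smul, map_sub, hs.deriv_cube]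
  module

theorem eq_zero_of_mem_hPart_of_mem_mPart {X : E} (h : modelDeriv E E s 1 X = X)
    (m : (X : GroupLieAlgebra 𝓘(ℝ, E) G) ∈ mPart (E := E) s) : X = 0 := by
  rw [mem_mPart_iff, h, h] at m
  have : (3 : ℝ) • X = 0 := by rw [← m]; module
  exact (smul_eq_zero.1 this).resolve_left (by norm_num)

/-- The projection `X ↦ X_𝔪` onto `𝔪`. -/
def IsThreeSymmetricPair.toM (hs : IsThreeSymmetricPair (E := E) s H) :
    GroupLieAlgebra 𝓘(ℝ, E) G →L[ℝ] mPart (E := E) s :=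
  ContinuousLinearMap.codRestrict
    (mProjection E s : GroupLieAlgebra 𝓘(ℝ, E) G →L[ℝ] GroupLieAlgebra 𝓘(ℝ, E) G)
    (mPart (E := E) s) hs.mProjection_mem

/-- The scalar product `B` on `𝔪`, extended to the Lie algebra by zero on `𝔥`. -/
def IsThreeSymmetricPair.extendForm (hs : IsThreeSymmetricPair (E := E) s H)
    (B : mPart (E := E) s →L[ℝ] mPart (E := E) s →L[ℝ] ℝ) : E →L[ℝ] E →L[ℝ] ℝ :=
  (pullbackForm B hs.toM : GroupLieAlgebra 𝓘(ℝ, E) G →L[ℝ] GroupLieAlgebra 𝓘(ℝ, E) G →L[ℝ] ℝ)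

theorem IsThreeSymmetricPair.extendForm_apply (hs : IsThreeSymmetricPair (E := E) s H)
    (B : mPart (E := E) s →L[ℝ] mPart (E := E) s →L[ℝ] ℝ) (X Y : E) :
    hs.extendForm B X Y = B (hs.toM X) (hs.toM Y) := rfl

variable {F : Type*} [NormedAddCommGroup F] [NormedSpace ℝ F]
  [ChartedSpace F (G ⧸ H)]

variable (E F H) in
/-- The derivative at the identity of `x ↦ b x H`. -/
def orbitDeriv (b : G) : E →L[ℝ] F := modelDeriv E F (fun x : G => ((b * x : G) : G ⧸ H)) 1

theorem IsQuotientManifold.smoothAt_mk (hq : IsQuotientManifold E F H) (b : G) :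
    SmoothAt E F (fun x : G => (x : G ⧸ H)) b :=
  (hq.isSubmersionAt b).contMDiffAt

variable [LieGroup 𝓘(ℝ, E) ∞ G]

theorem IsQuotientManifold.smoothAt_orbit (hq : IsQuotientManifold E F H) (b x : G) :
    SmoothAt E F (fun x : G => ((b * x : G) : G ⧸ H)) x :=
  (hq.smoothAt_mk (b * x)).comp_of_eq rfl (smoothAt_mul_left b x)

theorem modelDeriv_mul_left_inv_comp (b : G) (X : E) :
    modelDeriv E E (fun z : G => b⁻¹ * z) b (modelDeriv E E (fun z : G => b * z) 1 X) = X := by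
  have h := modelDeriv_comp (mul_one b) (smoothAt_mul_left (E := E) b⁻¹ b) (smoothAt_mul_left b 1)
  have h1 : (fun z : G => b⁻¹ * (b * z)) = fun z => z := by ext z; simp
  rw [h1, modelDeriv_id] at h
  exact (congrArg (fun T => T X) h).symm

theorem modelDeriv_mul_left_comp_inv (b : G) (X : E) :
    modelDeriv E E (fun z : G => b * z) 1 (modelDeriv E E (fun z : G => b⁻¹ * z) b X) = X := by
  have h := modelDeriv_comp (inv_mul_cancel b) (smoothAt_mul_left (E := E) b 1)
    (smoothAt_mul_left b⁻¹ b)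
  have h1 : (fun z : G => b * (b⁻¹ * z)) = fun z => z := by ext z; simp
  rw [h1, modelDeriv_id] at h
  exact (congrArg (fun T => T X) h).symm

theorem IsQuotientManifold.orbitDeriv_eq (hq : IsQuotientManifold E F H) (b : G) (X : E) :
    orbitDeriv E H F b X = modelDeriv E F (fun x : G => (x : G ⧸ H)) b
      (modelDeriv E E (fun z : G => b * z) 1 X) := by
  rw [orbitDeriv, modelDeriv_comp (mul_one b) (hq.smoothAt_mk b) (smoothAt_mul_left b 1)]
  rfl

/-- A vector of `𝔥` is the velocity of a curve of fixed points. A short arc of it through `1` is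
connected, so it lies in the identity component and hence in `H`, and `t ↦ b γ(t) H` is constant. -/
theorem IsQuotientManifold.orbitDeriv_eq_zero [CompleteSpace E] [IsManifold 𝓘(ℝ, F) ∞ (G ⧸ H)]
    (hq : IsQuotientManifold E F H) (hs : IsThreeSymmetricPair (E := E) s H) (b : G) {X : E}
    (hX : modelDeriv E E s 1 X = X) : orbitDeriv E H F b X = 0 := by
  obtain ⟨γ, h0, hγ, h1, hfix⟩ := hs.exists_fixed_curve hX
  have hc := modelDeriv_comp h0 (hq.smoothAt_orbit b 1) hγ
  obtain ⟨ε, hε, hball⟩ := Metric.eventually_nhds_iff_ball.1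
    (hfix.and hγ.eventually_mdifferentiableAt)
  have hmem : ∀ t ∈ Metric.ball (0 : ℝ) ε, γ t ∈ H := by
    intro t ht
    apply hs.component_le
    have hpre : IsPreconnected (γ '' Metric.ball (0 : ℝ) ε) :=
      (convex_ball (0 : ℝ) ε).isPreconnected.image γ
        fun r hr => (hball r hr).2.continuousAt.continuousWithinAt
    refine hpre.subset_connectedComponentIn ⟨0, Metric.mem_ball_self hε, h0⟩ ?_ ⟨t, ht, rfl⟩
    rintro _ ⟨r, hr, rfl⟩
    exact (hball r hr).1
  have hconst : (fun t => ((b * γ t : G) : G ⧸ H)) =ᶠ[𝓝 0] fun _ => (b : G ⧸ H) := by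
    filter_upwards [Metric.ball_mem_nhds (0 : ℝ) hε] with t ht
    exact QuotientGroup.mk_mul_of_mem b (hmem t ht)
  rw [modelDeriv_congr hconst, modelDeriv_const] at hc
  have h2 := congrArg (fun T => T 1) hc
  simp only [ContinuousLinearMap.comp_apply, h1] at h2
  exact h2.symm

/-- A kernel vector is, after translation by `b⁻¹`, the velocity of a curve in `H`, which `s` fixes
pointwise. With `orbitDeriv_eq_zero` this identifies the kernel with `𝔥`, so `𝔪` maps isomorphically
onto the tangent space. -/
theorem IsQuotientManifold.fixed_of_orbitDeriv_eq_zero (hq : IsQuotientManifold E F H)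
    [IsManifold 𝓘(ℝ, F) ∞ (G ⧸ H)]
    (hs : IsThreeSymmetricPair (E := E) s H) (b : G) {X : E} (hX : orbitDeriv E H F b X = 0) :
    modelDeriv E E s 1 X = X := by
  rw [hq.orbitDeriv_eq] at hX
  obtain ⟨γ, h0, hγ, h1, hfib⟩ := (hq.isSubmersionAt b).exists_curve_in_fiber hX
  have hβ : SmoothAt ℝ E (fun t => b⁻¹ * γ t) 0 := (smoothAt_mul_left b⁻¹ b).comp_of_eq h0 hγ
  have hβ1 : modelDeriv ℝ E (fun t => b⁻¹ * γ t) 0 1 = X := by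
    rw [modelDeriv_comp h0 (smoothAt_mul_left b⁻¹ b) hγ, ContinuousLinearMap.comp_apply, h1,
      modelDeriv_mul_left_inv_comp]
  have hsβ : (fun t => s (b⁻¹ * γ t)) =ᶠ[𝓝 0] fun t => b⁻¹ * γ t := by
    filter_upwards [hfib] with t ht
    exact hs.le_fixed _ (QuotientGroup.eq.1 ht.symm)
  have hc := modelDeriv_comp (f := fun t => b⁻¹ * γ t) (y := (1 : G)) (by simp [h0])
    (hs.smoothAt 1) hβ
  rw [modelDeriv_congr hsβ] at hc
  have h2 := congrArg (fun T => T 1) hc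
  simp only [ContinuousLinearMap.comp_apply, hβ1] at h2
  exact h2.symm

theorem IsQuotientManifold.surjective_orbitDeriv (hq : IsQuotientManifold E F H)
    [IsManifold 𝓘(ℝ, F) ∞ (G ⧸ H)] (b : G) : Function.Surjective (orbitDeriv E H F b) := by
  intro w
  obtain ⟨v, hv⟩ := (hq.isSubmersionAt b).surjective_modelDeriv w
  refine ⟨modelDeriv E E (fun z : G => b⁻¹ * z) b v, ?_⟩
  rw [hq.orbitDeriv_eq, modelDeriv_mul_left_comp_inv]
  exact hv

theorem IsQuotientManifold.orbitDeriv_mProjection [CompleteSpace E]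
    [IsManifold 𝓘(ℝ, F) ∞ (G ⧸ H)] (hq : IsQuotientManifold E F H)
    (hs : IsThreeSymmetricPair (E := E) s H) (b : G) (X : E) :
    orbitDeriv E H F b (mProjection E s X) = orbitDeriv E H F b X := by
  have := hq.orbitDeriv_eq_zero hs b (hs.sub_mProjection_mem X)
  rw [map_sub, sub_eq_zero] at this
  exact this.symm

/-- The inverse of `𝔪 ≅ T_{bH}(G/H)`, with values in the Lie algebra. -/
theorem IsQuotientManifold.exists_rightInverse [CompleteSpace E] [FiniteDimensional ℝ F]
    [IsManifold 𝓘(ℝ, F) ∞ (G ⧸ H)] (hq : IsQuotientManifold E F H)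
    (hs : IsThreeSymmetricPair (E := E) s H) (b : G) :
    ∃ T : F →L[ℝ] E, (∀ w, orbitDeriv E H F b (T w) = w) ∧
      (∀ w, (T w : GroupLieAlgebra 𝓘(ℝ, E) G) ∈ mPart (E := E) s) ∧
      ∀ X, T (orbitDeriv E H F b X) = mProjection E s X := by
  obtain ⟨g, hg⟩ := (orbitDeriv E H F b).toLinearMap.exists_rightInverse_of_surjective
    (LinearMap.range_eq_top.2 (hq.surjective_orbitDeriv b))
  have hT : ∀ w, orbitDeriv E H F b ((mProjection E s).comp (LinearMap.toContinuousLinearMap g) w)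
      = w := by
    intro w
    rw [ContinuousLinearMap.comp_apply, hq.orbitDeriv_mProjection hs]
    exact LinearMap.congr_fun hg w
  have hm : ∀ w, ((mProjection E s).comp (LinearMap.toContinuousLinearMap g) w :
      GroupLieAlgebra 𝓘(ℝ, E) G) ∈ mPart (E := E) s := fun w => hs.mProjection_mem _
  refine ⟨_, hT, hm, fun X => ?_⟩
  rw [← sub_eq_zero]
  refine eq_zero_of_mem_hPart_of_mem_mPart (s := s) (hq.fixed_of_orbitDeriv_eq_zero hs b ?_)
    ((mPart (E := E) s).sub_mem (hm _) (hs.mProjection_mem X))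
  rw [map_sub, hT, hq.orbitDeriv_mProjection hs, sub_self]

/-- This makes the `inverse` in `tangentToM` a genuine inverse and not the default value zero. -/
theorem IsQuotientManifold.inverse_mToTangent [CompleteSpace E] [FiniteDimensional ℝ F]
    [IsManifold 𝓘(ℝ, F) ∞ (G ⧸ H)] (hq : IsQuotientManifold E F H)
    (hs : IsThreeSymmetricPair (E := E) s H) (b : G) (X : mPart (E := E) s) :
    (mToTangent (E := E) (F := F) (H := H) s b).inverse
      (mToTangent (E := E) (F := F) (H := H) s b X) = X := by
  obtain ⟨T, hT, hm, hTX⟩ := hq.exists_rightInverse hs b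
  let T' : TangentSpace 𝓘(ℝ, F) (b : G ⧸ H) →L[ℝ] mPart (E := E) s :=
    ContinuousLinearMap.codRestrict
      (T : TangentSpace 𝓘(ℝ, F) (b : G ⧸ H) →L[ℝ] GroupLieAlgebra 𝓘(ℝ, E) G) (mPart (E := E) s) hm
  have h1 : ∀ X, T' (mToTangent (E := E) (F := F) (H := H) s b X) = X := by
    intro X
    apply Subtype.ext
    exact (hTX _).trans (mProjection_of_mem X.2)
  have : (mToTangent (E := E) (F := F) (H := H) s b).inverse = T' :=
    ContinuousLinearMap.inverse_eq (ContinuousLinearMap.ext hT) (ContinuousLinearMap.ext h1)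
  rw [this, h1]

theorem smoothAt_conj (k x : G) : SmoothAt E E (fun x : G => k * x * k⁻¹) x :=
  ContMDiffAt.mul (contMDiff_mul_left.contMDiffAt) contMDiffAt_const

theorem IsThreeSymmetricPair.deriv_conj_comm (hs : IsThreeSymmetricPair (E := E) s H) {k : G}
    (hk : k ∈ H) (X : E) :
    modelDeriv E E s 1 (modelDeriv E E (fun x : G => k * x * k⁻¹) 1 X) =
      modelDeriv E E (fun x : G => k * x * k⁻¹) 1 (modelDeriv E E s 1 X) := by
  have h1 := modelDeriv_comp (f := fun x : G => k * x * k⁻¹) (by simp) (hs.smoothAt 1)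
    (smoothAt_conj k 1)
  have h2 := modelDeriv_comp (g := fun x : G => k * x * k⁻¹) (map_one s) (smoothAt_conj k 1)
    (hs.smoothAt 1)
  have h3 : (fun x : G => s (k * x * k⁻¹)) = fun x => k * s x * k⁻¹ := by
    ext x
    rw [map_mul, map_mul, map_inv, hs.le_fixed k hk]
  rw [h3, h2] at h1
  exact (congrArg (fun T => T X) h1).symm

theorem IsThreeSymmetricPair.deriv_conj_mem (hs : IsThreeSymmetricPair (E := E) s H) {k : G}
    (hk : k ∈ H) {X : E} (hX : (X : GroupLieAlgebra 𝓘(ℝ, E) G) ∈ mPart (E := E) s) :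
    (modelDeriv E E (fun x : G => k * x * k⁻¹) 1 X : GroupLieAlgebra 𝓘(ℝ, E) G) ∈
      mPart (E := E) s := by
  rw [mem_mPart_iff] at hX ⊢
  rw [hs.deriv_conj_comm hk, hs.deriv_conj_comm hk, ← map_add, ← map_add, hX, map_zero]

/-- Since `bk · (k⁻¹xk)H = bxH`, replacing the representative `b` by `bk` twists the identification
with `𝔪` by `Ad(k⁻¹)`. -/
theorem IsQuotientManifold.orbitDeriv_mul_conj (hq : IsQuotientManifold E F H) (b : G) {k : G}
    (hk : k ∈ H) (X : E) :
    orbitDeriv E H F (b * k) (modelDeriv E E (fun x : G => k⁻¹ * x * k⁻¹⁻¹) 1 X) =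
      orbitDeriv E H F b X := by
  have h := modelDeriv_comp (f := fun x : G => k⁻¹ * x * k⁻¹⁻¹) (by simp)
    (hq.smoothAt_orbit (b * k) 1) (smoothAt_conj k⁻¹ 1)
  have h1 : (fun x : G => ((b * k * (k⁻¹ * x * k⁻¹⁻¹) : G) : G ⧸ H)) =
      fun x => ((b * x : G) : G ⧸ H) := by
    ext x
    have : b * k * (k⁻¹ * x * k⁻¹⁻¹) = b * x * k := by group
    rw [this]
    exact QuotientGroup.mk_mul_of_mem _ hk
  rw [h1] at h
  exact (congrArg (fun T => T X) h).symm

/-- The metric is defined through the chosen representative `q.out = bk` with `k ∈ H`.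
`Ad(H)`-invariance of `B` lets any other representative replace it, as is needed along a section. -/
theorem IsQuotientManifold.invariantMetric_orbitDeriv [CompleteSpace E] [FiniteDimensional ℝ F]
    [IsManifold 𝓘(ℝ, F) ∞ (G ⧸ H)] (hq : IsQuotientManifold E F H)
    (hs : IsThreeSymmetricPair (E := E) s H)
    {B : mPart (E := E) s →L[ℝ] mPart (E := E) s →L[ℝ] ℝ} (hB : IsInvariantScalarProduct s H B)
    (b : G) (X Y : E) :
    invariantMetric (F := F) (H := H) s B (b : G ⧸ H) (orbitDeriv E H F b X)
      (orbitDeriv E H F b Y) = hs.extendForm B X Y := by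
  obtain ⟨k, hk⟩ := QuotientGroup.mk_out_eq_mul H b
  let A (X : E) : mPart (E := E) s := ⟨modelDeriv E E (fun x : G => (k : G)⁻¹ * x * (k : G)⁻¹⁻¹) 1
    (mProjection E s X), hs.deriv_conj_mem (H.inv_mem k.2) (hs.mProjection_mem X)⟩
  have hA : ∀ X : E, tangentToM (E := E) (F := F) s (b : G ⧸ H) (orbitDeriv E H F b X) = A X := by
    intro X
    have h1 : orbitDeriv E H F b X = orbitDeriv E H F (b : G ⧸ H).out
        (A X : GroupLieAlgebra 𝓘(ℝ, E) G) := by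
      rw [hk]
      exact ((hq.orbitDeriv_mul_conj b k.2 _).trans (hq.orbitDeriv_mProjection hs b X)).symm
    rw [h1]
    exact hq.inverse_mToTangent hs _ (A X)
  change B (tangentToM (E := E) (F := F) s (b : G ⧸ H) (orbitDeriv E H F b X))
    (tangentToM (E := E) (F := F) s (b : G ⧸ H) (orbitDeriv E H F b Y)) = _
  rw [hA, hA, hs.extendForm_apply]
  exact hB.ad_invariant _ (H.inv_mem k.2) (hs.toM X) (hs.toM Y) (A X) (A Y) rfl rfl

/-- Near `bH`, the action of `a` is a local section followed by left translation and projection. -/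
theorem IsQuotientManifold.smoothAt_smul [IsManifold 𝓘(ℝ, F) ∞ (G ⧸ H)]
    (hq : IsQuotientManifold E F H) (a b : G) :
    SmoothAt F F (fun r : G ⧸ H => a • r) (b : G ⧸ H) := by
  obtain ⟨σ, hσb, hσ, hπσ⟩ := (hq.isSubmersionAt b).exists_local_section
  refine ContMDiffAt.congr_of_eventuallyEq ((hq.smoothAt_orbit a b).comp_of_eq hσb hσ) ?_
  filter_upwards [hπσ] with q hq'
  conv_lhs => rw [← hq']
  rfl

/-- An invariant distribution is constant in the identifications `𝔪 ≅ T_{bH}(G/H)`. -/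
theorem IsQuotientManifold.orbitDeriv_mem_iff [IsManifold 𝓘(ℝ, F) ∞ (G ⧸ H)]
    (hq : IsQuotientManifold E F H)
    {D : (q : G ⧸ H) → Submodule ℝ (TangentSpace 𝓘(ℝ, F) q)}
    (hD : ∀ (a : G) (q : G ⧸ H), (D q).map
      (mfderiv 𝓘(ℝ, F) 𝓘(ℝ, F) (fun r : G ⧸ H => a • r) q).toLinearMap = D (a • q))
    (b : G) (X : E) :
    orbitDeriv E H F b X ∈ D (b : G ⧸ H) ↔ orbitDeriv E H F 1 X ∈ D ((1 : G) : G ⧸ H) := by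
  have key : ∀ a b : G, orbitDeriv E H F b X ∈ D (b : G ⧸ H) →
      orbitDeriv E H F (a * b) X ∈ D ((a * b : G) : G ⧸ H) := by
    intro a b h
    have h1 := modelDeriv_comp (f := fun x : G => ((b * x : G) : G ⧸ H)) (y := (b : G ⧸ H))
      (by rw [mul_one]) (hq.smoothAt_smul a b) (hq.smoothAt_orbit b 1)
    have h2 : (fun x : G => a • ((b * x : G) : G ⧸ H)) =
        fun x : G => ((a * b * x : G) : G ⧸ H) := by
      ext x
      rw [mul_assoc]
      rfl
    rw [h2] at h1
    have h3 : orbitDeriv E H F (a * b) X =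
        modelDeriv F F (fun r : G ⧸ H => a • r) (b : G ⧸ H) (orbitDeriv E H F b X) :=
      congrArg (fun T => T X) h1
    rw [h3]
    have h4 := hD a (b : G ⧸ H)
    change _ ∈ D (a • (b : G ⧸ H))
    rw [← h4]
    exact Submodule.mem_map_of_mem (f := (mfderiv 𝓘(ℝ, F) 𝓘(ℝ, F) (fun r : G ⧸ H => a • r)
      (b : G ⧸ H)).toLinearMap) h
  constructor
  · intro h
    have := key b⁻¹ b h
    rwa [inv_mul_cancel] at this
  · intro h
    have := key b 1 h
    rwa [mul_one] at this

end Quotient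

/-! ### The canonical coframe of `G/H`. -/

section Coframe

variable {E : Type*} [NormedAddCommGroup E] [NormedSpace ℝ E]
  {G : Type*} [TopologicalSpace G] [ChartedSpace E G] [Group G]
  {s : MulAut G} {H : Subgroup G}

/-- The Lie bracket, on the model space. -/
def modelBracket (E : Type*) [NormedAddCommGroup E] [NormedSpace ℝ E]
    (G : Type*) [TopologicalSpace G] [ChartedSpace E G] [Group G]
    (X Y : GroupLieAlgebra 𝓘(ℝ, E) G) : E := (⁅X, Y⁆ : GroupLieAlgebra 𝓘(ℝ, E) G)

theorem modelBracket_swap (X Y : E) : modelBracket E G X Y = -modelBracket E G Y X :=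
  VectorField.mlieBracket_swap_apply (I := 𝓘(ℝ, E)) (x := (1 : G))
    (V := mulInvariantVectorField (X : GroupLieAlgebra 𝓘(ℝ, E) G))
    (W := mulInvariantVectorField (Y : GroupLieAlgebra 𝓘(ℝ, E) G))

theorem IsThreeSymmetricPair.toM_mProjection (hs : IsThreeSymmetricPair (E := E) s H) (X : E) :
    hs.toM (mProjection E s X) = hs.toM X :=
  Subtype.ext (mProjection_of_mem (E := E) (hs.mProjection_mem X))

theorem IsThreeSymmetricPair.toM_of_mem (hs : IsThreeSymmetricPair (E := E) s H) {X : E}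
    (hX : (X : GroupLieAlgebra 𝓘(ℝ, E) G) ∈ mPart (E := E) s) : hs.toM X = ⟨X, hX⟩ :=
  Subtype.ext (mProjection_of_mem (E := E) hX)

/-- Natural reductivity turns `B(X, [Y, Z]_𝔪)` into `B([X, Y]_𝔪, Z)`, which is antisymmetric in `X`
and `Y`. This is the skewness that `koszul_of_coframe` requires. -/
theorem IsThreeSymmetricPair.extendForm_bracket_skew (hs : IsThreeSymmetricPair (E := E) s H)
    {B : mPart (E := E) s →L[ℝ] mPart (E := E) s →L[ℝ] ℝ} (hnat : IsNaturallyReductive s B)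
    {X Y Z : E} (hX : (X : GroupLieAlgebra 𝓘(ℝ, E) G) ∈ mPart (E := E) s)
    (hY : (Y : GroupLieAlgebra 𝓘(ℝ, E) G) ∈ mPart (E := E) s)
    (hZ : (Z : GroupLieAlgebra 𝓘(ℝ, E) G) ∈ mPart (E := E) s) :
    hs.extendForm B X (mProjection E s (modelBracket E G Y Z)) +
      hs.extendForm B Y (mProjection E s (modelBracket E G X Z)) = 0 := by
  have hc : ∀ W : E, IsMComponent s (W : GroupLieAlgebra 𝓘(ℝ, E) G) (hs.toM W) :=
    hs.sub_mProjection_mem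
  have h : ∀ {X Y : E}, (X : GroupLieAlgebra 𝓘(ℝ, E) G) ∈ mPart (E := E) s →
      (Y : GroupLieAlgebra 𝓘(ℝ, E) G) ∈ mPart (E := E) s →
      hs.extendForm B X (mProjection E s (modelBracket E G Y Z)) =
        hs.extendForm B (modelBracket E G X Y) Z := by
    intro X Y hX hY
    rw [hs.extendForm_apply, hs.extendForm_apply, hs.toM_mProjection, hs.toM_of_mem hX,
      hs.toM_of_mem hZ]
    exact (hnat ⟨X, hX⟩ ⟨Y, hY⟩ ⟨Z, hZ⟩ _ _ (hc _) (hc _)).symm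
  rw [h hX hY, h hY hX, modelBracket_swap X Y, map_neg]
  exact neg_add_cancel _

variable [LieGroup 𝓘(ℝ, E) ∞ G] {F : Type*} [NormedAddCommGroup F] [NormedSpace ℝ F]

/-- The left Maurer-Cartan form, pulled back under a map `σ` into the group. -/
theorem exists_maurerCartan {σ : F → G} {y : F} (hσ : SmoothAt F E σ y) :
    ∃ η : F → F →L[ℝ] E, DifferentiableAt ℝ η y ∧
      (∀ᶠ x in 𝓝 y, η x = modelDeriv F E (fun z => (σ x)⁻¹ * σ z) x) ∧
      ∀ u v, fderiv ℝ η y u v - fderiv ℝ η y v u = -modelBracket E G (η y u) (η y v) := by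
  set e := extChartAt 𝓘(ℝ, E) (1 : G) with he
  have hes : SmoothAt E E e 1 := smoothAt_extChartAt (mem_extChartAt_source (1 : G))
  have hn0 : SmoothAt F E (fun z => (σ y)⁻¹ * σ z) y :=
    (smoothAt_mul_left _ _).comp_of_eq rfl hσ
  have hι0 : SmoothAt F E (fun z => (σ z)⁻¹ * σ y) y :=
    (hσ.inv).mul contMDiffAt_const
  -- Factor `σ(x)⁻¹σ(z) = (σ(x)⁻¹σ(y))(σ(y)⁻¹σ(z))`. For `x` and `z` near `y` both factors are near
  -- `1`, so a single chart at the identity is enough.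
  let n : F → E := fun z => e ((σ y)⁻¹ * σ z)
  let ι : F → E := fun z => e ((σ z)⁻¹ * σ y)
  have hn : SmoothAt F E n y := hes.comp_of_eq (inv_mul_cancel _) hn0
  have hι : SmoothAt F E ι y := hes.comp_of_eq (inv_mul_cancel _) hι0
  rw [smoothAt_iff_contDiffAt] at hn hι
  have hsrc : e.source ∈ 𝓝 (1 : G) := extChartAt_source_mem_nhds (I := 𝓘(ℝ, E)) (1 : G)
  have hnt : ∀ᶠ z in 𝓝 y, (σ y)⁻¹ * σ z ∈ e.source := by
    have := hn0.continuousAt.tendsto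
    rw [inv_mul_cancel] at this
    exact this.eventually hsrc
  have hιt : ∀ᶠ z in 𝓝 y, (σ z)⁻¹ * σ y ∈ e.source := by
    have := hι0.continuousAt.tendsto
    rw [inv_mul_cancel] at this
    exact this.eventually hsrc
  have hmul : ∀ {x z}, (σ x)⁻¹ * σ y ∈ e.source → (σ y)⁻¹ * σ z ∈ e.source →
      chartMul E G (ι x, n z) = e ((σ x)⁻¹ * σ z) := by
    intro x z hx hz
    change e (e.symm (e ((σ x)⁻¹ * σ y)) * e.symm (e ((σ y)⁻¹ * σ z))) = _
    rw [e.left_inv hx, e.left_inv hz]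
    congr 1
    group
  have hinv : ∀ᶠ x in 𝓝 y, chartMul E G (ι x, n x) = e 1 := by
    filter_upwards [hnt, hιt] with x hx hx'
    rw [hmul hx' hx, inv_mul_cancel]
  have hle : (2 : WithTop ℕ∞) ≤ ∞ := ENat.LEInfty.out
  obtain ⟨h1, h2, h3⟩ := maurerCartan_of_groupLaw
    ((contDiffAt_chartMul (E := E) (G := G)).of_le hle) chartMul_left chartMul_right
    (hn.of_le hle) (hι.of_le hle) (show n y = e 1 from congrArg e (inv_mul_cancel _))
    (show ι y = e 1 from congrArg e (inv_mul_cancel _)) hinv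
  refine ⟨_, h1, ?_, ?_⟩
  · filter_upwards [hιt, hnt.eventually_nhds, hσ.eventually_mdifferentiableAt] with x hx hx' hσx
    have h4 : (fun z => chartMul E G (ι x, n z)) =ᶠ[𝓝 x] fun z => e ((σ x)⁻¹ * σ z) := by
      filter_upwards [hx'] with z hz using hmul hx hz
    rw [h4.fderiv_eq, ← modelDeriv_eq_fderiv]
    have h5 : MDifferentiableAt 𝓘(ℝ, F) 𝓘(ℝ, E) (fun z => (σ x)⁻¹ * σ z) x :=
      MDifferentiableAt.comp x (smoothAt_mul_left (E := E) (σ x)⁻¹ (σ x)).mdifferentiableAt hσx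
    rw [modelDeriv_comp_of_mdifferentiableAt (f := fun z => (σ x)⁻¹ * σ z) (inv_mul_cancel _)
      hes.mdifferentiableAt h5, he, modelDeriv_extChartAt]
    exact ContinuousLinearMap.id_comp _
  · intro u v
    rw [h3]
    simp only [h2]
    exact congrArg Neg.neg (bracket_eq_chartMul (E := E) (G := G) _ _).symm

variable [ChartedSpace F (G ⧸ H)] [IsManifold 𝓘(ℝ, F) ∞ (G ⧸ H)]
  [FiniteDimensional ℝ E] [FiniteDimensional ℝ F]

/-- A local section of `G → G/H`, tangent to the left translates of `𝔪` at one point. -/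
theorem IsQuotientManifold.exists_horizontal_section (hq : IsQuotientManifold E F H)
    (hs : IsThreeSymmetricPair (E := E) s H) (p : G ⧸ H) :
    ∃ σ : F → G, SmoothAt F E σ (extChartAt 𝓘(ℝ, F) p p) ∧
      (∀ᶠ y in 𝓝 (extChartAt 𝓘(ℝ, F) p p), (σ y : G ⧸ H) = (extChartAt 𝓘(ℝ, F) p).symm y) ∧
      ∀ v, (modelDeriv F E (fun z => (σ (extChartAt 𝓘(ℝ, F) p p))⁻¹ * σ z)
        (extChartAt 𝓘(ℝ, F) p p) v : GroupLieAlgebra 𝓘(ℝ, E) G) ∈ mPart (E := E) s := by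
  obtain ⟨a, rfl⟩ := QuotientGroup.mk_surjective p
  set c := extChartAt 𝓘(ℝ, F) (a : G ⧸ H) with hc
  set e := extChartAt 𝓘(ℝ, E) (1 : G) with he
  obtain ⟨T, hT, hTm, -⟩ := hq.exists_rightInverse hs a
  have he1 : e.symm (e 1) = 1 := extChartAt_to_inv (I := 𝓘(ℝ, E)) (1 : G)
  have hesy : SmoothAt E E e.symm (e 1) :=
    smoothAt_extChartAt_symm (mem_extChartAt_target (I := 𝓘(ℝ, E)) (1 : G))
  have hcs : SmoothAt F F c (a : G ⧸ H) := smoothAt_extChartAt (mem_extChartAt_source _)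
  -- The section parametrizes the slice `w ↦ a · e⁻¹(e(1) + T w)`, which is tangent to the translate
  -- of `𝔪` at `a`.
  let l : F → E := fun w => e 1 + T w
  have hl0 : l 0 = e 1 := by simp [l]
  have hl : SmoothAt F E l 0 := by
    rw [smoothAt_iff_contDiffAt]
    fun_prop
  have hlT : modelDeriv F E l 0 = T := by
    rw [modelDeriv_eq_fderiv]
    exact (T.hasFDerivAt.const_add (e 1)).fderiv
  have hτ : SmoothAt F E (fun w => e.symm (l w)) 0 := hesy.comp_of_eq hl0 hl
  have hτ0 : e.symm (l 0) = 1 := by rw [hl0, he1]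
  have hτT : modelDeriv F E (fun w => e.symm (l w)) 0 = T := by
    rw [modelDeriv_comp hl0 hesy hl, hlT, he, modelDeriv_extChartAt_symm]
    exact ContinuousLinearMap.id_comp _
  have hπ : SmoothAt F F (fun w => ((a * e.symm (l w) : G) : G ⧸ H)) 0 :=
    SmoothAt.comp_of_eq (g := fun x : G => ((a * x : G) : G ⧸ H)) hτ0 (hq.smoothAt_orbit a 1) hτ
  have hπ0 : ((a * e.symm (l 0) : G) : G ⧸ H) = a := by rw [hτ0, mul_one]
  let κ : F → F := fun w => c ((a * e.symm (l w) : G) : G ⧸ H)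
  have hκ : SmoothAt F F κ 0 := hcs.comp_of_eq hπ0 hπ
  have hκ0 : κ 0 = c a := by simp only [κ, hπ0]
  -- `T` is a right inverse of the orbit derivative, so the slice read in the chart of `G/H` has
  -- derivative the identity; its local inverse `ψ` turns the slice into a section.
  have hκ' : modelDeriv F F κ 0 = ContinuousLinearMap.id ℝ F := by
    rw [modelDeriv_comp (f := fun w => ((a * e.symm (l w) : G) : G ⧸ H)) hπ0 hcs hπ,
      modelDeriv_comp (g := fun x : G => ((a * x : G) : G ⧸ H)) (f := fun w => e.symm (l w))
        hτ0 (hq.smoothAt_orbit a 1) hτ,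
      hc, modelDeriv_extChartAt, hτT]
    exact ContinuousLinearMap.ext hT
  rw [smoothAt_iff_contDiffAt] at hκ
  have hκf : HasFDerivAt κ ((ContinuousLinearEquiv.refl ℝ F : F ≃L[ℝ] F) : F →L[ℝ] F) 0 := by
    have := (hκ.differentiableAt (by simp)).hasFDerivAt
    rw [← modelDeriv_eq_fderiv, hκ'] at this
    exact this
  have hstrict := hκ.hasStrictFDerivAt' hκf (by simp)
  let ψ : F → F := hκ.localInverse hκf (by simp)
  have hψ : SmoothAt F F ψ (c a) := by
    rw [smoothAt_iff_contDiffAt, ← hκ0]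
    exact hκ.to_localInverse hκf (by simp)
  have hψ0 : ψ (c a) = 0 := by
    rw [← hκ0]
    exact hκ.localInverse_apply_image hκf (by simp)
  have hψr : ∀ᶠ y in 𝓝 (c a), κ (ψ y) = y := by
    rw [← hκ0]
    exact hstrict.eventually_right_inverse
  have hτψ : SmoothAt F E (fun y => e.symm (l (ψ y))) (c a) :=
    SmoothAt.comp_of_eq (g := fun w => e.symm (l w)) hψ0 hτ hψ
  refine ⟨fun y => a * e.symm (l (ψ y)), (smoothAt_mul_left a _).comp_of_eq rfl hτψ, ?_, ?_⟩
  · have hπψ : Tendsto (fun y => ((a * e.symm (l (ψ y)) : G) : G ⧸ H)) (𝓝 (c a))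
        (𝓝 (a : G ⧸ H)) := by
      have h := hπ.continuousAt.tendsto
      rw [hπ0] at h
      have h' := hψ.continuousAt.tendsto
      rw [hψ0] at h'
      exact h.comp h'
    filter_upwards [hψr, hπψ.eventually (extChartAt_source_mem_nhds (I := 𝓘(ℝ, F)) (a : G ⧸ H))]
      with y hy hy'
    rw [← c.left_inv hy']
    exact congrArg c.symm hy
  · intro v
    have h1 : (fun z => (a * e.symm (l (ψ (c a))))⁻¹ * (a * e.symm (l (ψ z)))) =
        fun z => e.symm (l (ψ z)) := by
      ext z
      rw [hψ0, hτ0, mul_one, inv_mul_cancel_left]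
    rw [h1, modelDeriv_comp (g := fun w => e.symm (l w)) hψ0 hτ hψ, hτT]
    exact hTm _

/-- The canonical coframe of `G/H` at a point: `Θ y` is the inverse of an identification
`𝔪 ≅ T_{bH}(G/H)`, read in the preferred chart, and `dΘ = -[Θ, Θ]_𝔪` at the point. -/
theorem IsQuotientManifold.exists_coframe (hq : IsQuotientManifold E F H)
    (hs : IsThreeSymmetricPair (E := E) s H) (p : G ⧸ H) :
    ∃ Θ : F → F →L[ℝ] E, DifferentiableAt ℝ Θ (extChartAt 𝓘(ℝ, F) p p) ∧
      (∀ᶠ y in 𝓝 (extChartAt 𝓘(ℝ, F) p p), ∃ b : G, (b : G ⧸ H) = (extChartAt 𝓘(ℝ, F) p).symm y ∧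
        ∀ v, orbitDeriv E H F b (Θ y v) = modelDeriv F F (extChartAt 𝓘(ℝ, F) p).symm y v) ∧
      (∀ y v, (Θ y v : GroupLieAlgebra 𝓘(ℝ, E) G) ∈ mPart (E := E) s) ∧
      (∀ u v, (fderiv ℝ Θ (extChartAt 𝓘(ℝ, F) p p) u v : GroupLieAlgebra 𝓘(ℝ, E) G) ∈
        mPart (E := E) s) ∧
      ∀ u v, fderiv ℝ Θ (extChartAt 𝓘(ℝ, F) p p) u v - fderiv ℝ Θ (extChartAt 𝓘(ℝ, F) p p) v u =
        -mProjection E s (modelBracket E G (Θ (extChartAt 𝓘(ℝ, F) p p) u)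
          (Θ (extChartAt 𝓘(ℝ, F) p p) v)) := by
  obtain ⟨σ, hσ, hπσ, hhor⟩ := hq.exists_horizontal_section hs p
  obtain ⟨η, hη, hησ, hdη⟩ := exists_maurerCartan hσ
  set y₀ := extChartAt 𝓘(ℝ, F) p p
  have hd : HasFDerivAt (fun y => (mProjection E s).comp (η y)) _ y₀ :=
    (hasFDerivAt_const (mProjection E s) y₀).clm_comp hη.hasFDerivAt
  have hd' : ∀ u v, fderiv ℝ (fun y => (mProjection E s).comp (η y)) y₀ u v =
      mProjection E s (fderiv ℝ η y₀ u v) := by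
    intro u v
    rw [hd.fderiv]
    simp
  -- Horizontality at `y₀` removes the `𝔥`-part of `η` there. Without it, projecting `dη = -[η, η]`
  -- to `𝔪` would also produce brackets of `𝔥` with `𝔪`.
  have hval : ∀ v, mProjection E s (η y₀ v) = η y₀ v := by
    intro v
    refine mProjection_of_mem ?_
    rw [hησ.self_of_nhds]
    exact hhor v
  refine ⟨fun y => (mProjection E s).comp (η y), hd.differentiableAt, ?_,
    fun y v => hs.mProjection_mem _, fun u v => ?_, fun u v => ?_⟩
  · filter_upwards [hησ, hπσ.eventually_nhds, hσ.eventually_mdifferentiableAt] with y hy hy' hσy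
    refine ⟨σ y, hy'.self_of_nhds, fun v => ?_⟩
    rw [ContinuousLinearMap.comp_apply, hq.orbitDeriv_mProjection hs, hy]
    have h5 : MDifferentiableAt 𝓘(ℝ, F) 𝓘(ℝ, E) (fun z => (σ y)⁻¹ * σ z) y :=
      MDifferentiableAt.comp y (smoothAt_mul_left (E := E) (σ y)⁻¹ (σ y)).mdifferentiableAt hσy
    have h6 := modelDeriv_comp_of_mdifferentiableAt (f := fun z => (σ y)⁻¹ * σ z)
      (inv_mul_cancel _) (hq.smoothAt_orbit (σ y) 1).mdifferentiableAt h5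
    have h7 : (fun z => ((σ y * ((σ y)⁻¹ * σ z) : G) : G ⧸ H)) =ᶠ[𝓝 y]
        (extChartAt 𝓘(ℝ, F) p).symm := by
      filter_upwards [hy'] with z hz
      rw [mul_inv_cancel_left, hz]
    rw [modelDeriv_congr h7] at h6
    exact (congrArg (fun T => T v) h6).symm
  · rw [hd']
    exact hs.mProjection_mem _
  · rw [hd', hd', ← map_sub, hdη, map_neg]
    simp only [ContinuousLinearMap.comp_apply, hval]

end Coframe

/-! ### Coordinate expressions of a smooth map. -/

section Immersion

variable {F : Type*} [NormedAddCommGroup F] [NormedSpace ℝ F]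
  {M : Type*} [TopologicalSpace M] [ChartedSpace F M]
  {E' : Type*} [NormedAddCommGroup E'] [NormedSpace ℝ E']
  {N : Type*} [TopologicalSpace N] [ChartedSpace E' N]

theorem writtenInExtChartAt_self (f : N → M) (x : N) :
    writtenInExtChartAt 𝓘(ℝ, E') 𝓘(ℝ, F) x f (extChartAt 𝓘(ℝ, E') x x) =
      extChartAt 𝓘(ℝ, F) (f x) (f x) := by
  rw [writtenInExtChartAt, Function.comp_apply, Function.comp_apply, extChartAt_to_inv]

variable [IsManifold 𝓘(ℝ, F) ∞ M] [IsManifold 𝓘(ℝ, E') ∞ N]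

theorem smoothAt_writtenInExtChartAt {f : N → M} {x : N} (hf : SmoothAt E' F f x) :
    SmoothAt E' F (writtenInExtChartAt 𝓘(ℝ, E') 𝓘(ℝ, F) x f) (extChartAt 𝓘(ℝ, E') x x) := by
  have h1 : SmoothAt E' F (fun z => f ((extChartAt 𝓘(ℝ, E') x).symm z))
      (extChartAt 𝓘(ℝ, E') x x) :=
    hf.comp_of_eq (extChartAt_to_inv x) (smoothAt_extChartAt_symm (mem_extChartAt_target x))
  exact (smoothAt_extChartAt (mem_extChartAt_source (f x))).comp_of_eq
    (f := fun z => f ((extChartAt 𝓘(ℝ, E') x).symm z)) (congrArg f (extChartAt_to_inv x)) h1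

theorem fderiv_writtenInExtChartAt {f : N → M} {x : N} (hf : SmoothAt E' F f x) :
    fderiv ℝ (writtenInExtChartAt 𝓘(ℝ, E') 𝓘(ℝ, F) x f) (extChartAt 𝓘(ℝ, E') x x) =
      modelDeriv E' F f x := by
  have hx := smoothAt_extChartAt_symm (mem_extChartAt_target (I := 𝓘(ℝ, E')) x)
  have h0 := extChartAt_to_inv (I := 𝓘(ℝ, E')) x
  have h1 : SmoothAt E' F (fun z => f ((extChartAt 𝓘(ℝ, E') x).symm z))
      (extChartAt 𝓘(ℝ, E') x x) := hf.comp_of_eq h0 hx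
  have h2 := modelDeriv_comp (f := fun z => f ((extChartAt 𝓘(ℝ, E') x).symm z)) (congrArg f h0)
    (smoothAt_extChartAt (mem_extChartAt_source (I := 𝓘(ℝ, F)) (f x))) h1
  rw [modelDeriv_comp h0 hf hx, modelDeriv_extChartAt, modelDeriv_extChartAt_symm,
    modelDeriv_eq_fderiv] at h2
  exact h2

/-- Near the base point, the derivative of the coordinate expression of `f` takes values in the
range of the derivative of `f`. -/
theorem eventually_modelDeriv_symm_mem_range {f : N → M} (hf : ∀ x, SmoothAt E' F f x) (x : N) :
    ∀ᶠ z in 𝓝 (extChartAt 𝓘(ℝ, E') x x), ∃ x' : N,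
      f x' = (extChartAt 𝓘(ℝ, F) (f x)).symm (writtenInExtChartAt 𝓘(ℝ, E') 𝓘(ℝ, F) x f z) ∧
      ∀ v, modelDeriv F F (extChartAt 𝓘(ℝ, F) (f x)).symm
          (writtenInExtChartAt 𝓘(ℝ, E') 𝓘(ℝ, F) x f z)
          (fderiv ℝ (writtenInExtChartAt 𝓘(ℝ, E') 𝓘(ℝ, F) x f) z v) ∈
        (modelDeriv E' F f x').toLinearMap.range := by
  set c := extChartAt 𝓘(ℝ, E') x
  set d := extChartAt 𝓘(ℝ, F) (f x)
  have hx : SmoothAt E' E' c.symm (c x) := smoothAt_extChartAt_symm (mem_extChartAt_target x)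
  have h0 : c.symm (c x) = x := extChartAt_to_inv x
  have hfc : Tendsto (fun z => f (c.symm z)) (𝓝 (c x)) (𝓝 (f x)) := by
    have h1 : SmoothAt E' F (fun z => f (c.symm z)) (c x) := (hf x).comp_of_eq h0 hx
    have := h1.continuousAt.tendsto
    rwa [h0] at this
  have hsrc := hfc.eventually (extChartAt_source_mem_nhds (I := 𝓘(ℝ, F)) (f x))
  filter_upwards [extChartAt_target_mem_nhds (I := 𝓘(ℝ, E')) x, hsrc.eventually_nhds] with z hz hz'
  have hz1 : f (c.symm z) ∈ d.source := hz'.self_of_nhds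
  refine ⟨c.symm z, (d.left_inv hz1).symm, fun v => ?_⟩
  have hcz : SmoothAt E' E' c.symm z := smoothAt_extChartAt_symm hz
  have hfz : SmoothAt E' F (fun z => f (c.symm z)) z := (hf _).comp_of_eq rfl hcz
  have hφ : SmoothAt E' F (fun z => d (f (c.symm z))) z :=
    (smoothAt_extChartAt hz1).comp_of_eq rfl hfz
  have h1 := modelDeriv_comp (f := fun z => d (f (c.symm z))) rfl
    (smoothAt_extChartAt_symm (d.map_source hz1)) hφ
  have h2 : (fun z => d.symm (d (f (c.symm z)))) =ᶠ[𝓝 z] fun z => f (c.symm z) := by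
    filter_upwards [hz'] with w hw using d.left_inv hw
  have h3 := modelDeriv_congr (E := E') (F := F) h2
  rw [modelDeriv_comp rfl (hf _) hcz] at h3
  rw [h3, modelDeriv_eq_fderiv] at h1
  exact ⟨modelDeriv E' E' c.symm z v, congrArg (fun T => T v) h1⟩

end Immersion

/-! ### Christoffel symbols and covariant derivatives through the coframe. -/

section ThreeSymmetric

variable {E : Type*} [NormedAddCommGroup E] [NormedSpace ℝ E] [FiniteDimensional ℝ E]
  {G : Type*} [TopologicalSpace G] [ChartedSpace E G] [Group G]
  [LieGroup 𝓘(ℝ, E) ∞ G]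
  {s : MulAut G} {H : Subgroup G}
  {F : Type*} [NormedAddCommGroup F] [NormedSpace ℝ F] [FiniteDimensional ℝ F]
  [ChartedSpace F (G ⧸ H)] [IsManifold 𝓘(ℝ, F) ∞ (G ⧸ H)]
  {B : mPart (E := E) s →L[ℝ] mPart (E := E) s →L[ℝ] ℝ}

/-- The Christoffel symbol of the invariant metric in terms of a canonical coframe. -/
theorem coframe_christoffel (hs : IsThreeSymmetricPair (E := E) s H)
    (hq : IsQuotientManifold E F H) (hB : IsInvariantScalarProduct s H B)
    (hnat : IsNaturallyReductive s B) {p : G ⧸ H} {Θ : F → F →L[ℝ] E}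
    (hΘ : DifferentiableAt ℝ Θ (extChartAt 𝓘(ℝ, F) p p))
    (hΘb : ∀ᶠ y in 𝓝 (extChartAt 𝓘(ℝ, F) p p), ∃ b : G,
      (b : G ⧸ H) = (extChartAt 𝓘(ℝ, F) p).symm y ∧
        ∀ v, orbitDeriv E H F b (Θ y v) = modelDeriv F F (extChartAt 𝓘(ℝ, F) p).symm y v)
    (hΘm : ∀ y v, (Θ y v : GroupLieAlgebra 𝓘(ℝ, E) G) ∈ mPart (E := E) s)
    (hΘm' : ∀ u v, (fderiv ℝ Θ (extChartAt 𝓘(ℝ, F) p p) u v : GroupLieAlgebra 𝓘(ℝ, E) G) ∈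
      mPart (E := E) s)
    (hdΘ : ∀ u v, fderiv ℝ Θ (extChartAt 𝓘(ℝ, F) p p) u v -
      fderiv ℝ Θ (extChartAt 𝓘(ℝ, F) p p) v u =
        -mProjection E s (modelBracket E G (Θ (extChartAt 𝓘(ℝ, F) p p) u)
          (Θ (extChartAt 𝓘(ℝ, F) p p) v))) (u v : F) :
    Θ (extChartAt 𝓘(ℝ, F) p p) (christoffel (invariantMetric (F := F) (H := H) s B) p u v) =
      (1 / 2 : ℝ) • (fderiv ℝ Θ (extChartAt 𝓘(ℝ, F) p p) u v +
        fderiv ℝ Θ (extChartAt 𝓘(ℝ, F) p p) v u) := by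
  set y₀ := extChartAt 𝓘(ℝ, F) p p with hy₀
  set g := invariantMetric (F := F) (H := H) s B
  -- The equality is needed on a neighbourhood, since the Christoffel symbol differentiates the
  -- metric.
  have hg : coordMetric g p =ᶠ[𝓝 y₀] fun y => pullbackForm (hs.extendForm B) (Θ y) := by
    filter_upwards [hΘb] with y hy
    obtain ⟨b, hb, hbv⟩ := hy
    ext u v
    have key : ∀ (q : G ⧸ H), (b : G ⧸ H) = q → ∀ X Y : E,
        g q (orbitDeriv E H F b X) (orbitDeriv E H F b Y) = hs.extendForm B X Y := by
      rintro q rfl X Y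
      exact hq.invariantMetric_orbitDeriv hs hB b X Y
    have h := key _ hb (Θ y u) (Θ y v)
    rw [hbv, hbv] at h
    exact h
  obtain ⟨a, -, hav⟩ := hΘb.self_of_nhds
  have hav' : ∀ v, orbitDeriv E H F a (Θ y₀ v) = v := by
    intro v
    have := hav v
    rw [hy₀, modelDeriv_extChartAt_symm] at this
    exact this
  -- The difference of the two sides is killed by the orbit derivative, so it lies in `𝔥`; it also
  -- lies in `𝔪`, hence is zero.
  have hsurj : ∀ X : E, (X : GroupLieAlgebra 𝓘(ℝ, E) G) ∈ mPart (E := E) s →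
      Θ y₀ (orbitDeriv E H F a X) = X := by
    intro X hX
    rw [← sub_eq_zero]
    refine eq_zero_of_mem_hPart_of_mem_mPart (s := s) (hq.fixed_of_orbitDeriv_eq_zero hs a ?_)
      ((mPart (E := E) s).sub_mem (hΘm _ _) hX)
    rw [map_sub, hav', sub_self]
  have hform : ∀ X Y : E, hs.extendForm B X Y = hs.extendForm B Y X := fun X Y => hB.symm _ _
  have hskew : ∀ u v w, hs.extendForm B (Θ y₀ v) (fderiv ℝ Θ y₀ u w - fderiv ℝ Θ y₀ w u) +
      hs.extendForm B (Θ y₀ u) (fderiv ℝ Θ y₀ v w - fderiv ℝ Θ y₀ w v) = 0 := by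
    intro u v w
    rw [hdΘ, hdΘ, map_neg, map_neg, ← neg_add,
      hs.extendForm_bracket_skew hnat (hΘm _ _) (hΘm _ _) (hΘm _ _), neg_zero]
  set X : E := (1 / 2 : ℝ) • (fderiv ℝ Θ y₀ u v + fderiv ℝ Θ y₀ v u)
  have hX : (X : GroupLieAlgebra 𝓘(ℝ, E) G) ∈ mPart (E := E) s :=
    (mPart (E := E) s).smul_mem _ ((mPart (E := E) s).add_mem (hΘm' u v) (hΘm' v u))
  have hK := koszul_of_coframe (hs.extendForm B) hform hΘ hskew u v _ (hsurj X hX)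
  -- Nondegeneracy of `B` passes to the coordinate metric, so applying its `inverse` to the Koszul
  -- identity `hK` gives the Christoffel symbol.
  have hnd : ∀ u, (∀ v, pullbackForm (hs.extendForm B) (Θ y₀) u v = 0) → u = 0 := by
    intro u hu
    have h1 : hs.toM (Θ y₀ u) = 0 := by
      suffices h : ∀ (Y : E) (hY : (Y : GroupLieAlgebra 𝓘(ℝ, E) G) ∈ mPart (E := E) s),
          B (hs.toM (Θ y₀ u)) ⟨Y, hY⟩ = 0 from hB.nondegenerate _ fun Y => h Y.1 Y.2
      intro Y hY
      have h2 := hu (orbitDeriv E H F a Y)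
      rw [pullbackForm_apply, hsurj Y hY, hs.extendForm_apply] at h2
      rwa [hs.toM_of_mem hY] at h2
    rw [hs.toM_of_mem (hΘm _ _)] at h1
    have h3 : Θ y₀ u = 0 := congrArg Subtype.val h1
    rw [← hav' u, h3, map_zero]
  have hΓ : christoffel g p u v = orbitDeriv E H F a X := by
    change (coordMetric g p y₀).inverse ((1 / 2 : ℝ) • (fderiv ℝ (coordMetric g p) y₀ u v +
      fderiv ℝ (coordMetric g p) y₀ v u - ((fderiv ℝ (coordMetric g p) y₀).flip u).flip v)) = _
    rw [hg.fderiv_eq, hg.self_of_nhds, ← hK]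
    exact inverse_apply_apply_of_injective _ hnd _
  rw [hΓ, hsurj X hX]

/-- An integral manifold of an invariant distribution is mapped into the distribution by the
covariant derivative. -/
theorem covDerivAlong_mem_range (hs : IsThreeSymmetricPair (E := E) s H)
    (hq : IsQuotientManifold E F H) (hB : IsInvariantScalarProduct s H B)
    (hnat : IsNaturallyReductive s B)
    {E' : Type*} [NormedAddCommGroup E'] [NormedSpace ℝ E']
    {N : Type*} [TopologicalSpace N] [ChartedSpace E' N] [IsManifold 𝓘(ℝ, E') ∞ N]
    {f : N → G ⧸ H} (hf : ∀ x, SmoothAt E' F f x)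
    (hinv : IsInvariantSubmanifold (F := F) (E' := E') f) (x : N) (u v : E') :
    ∃ w : E', modelDeriv E' F f x w =
      covDerivAlong (E' := E') (invariantMetric (F := F) (H := H) s B) f x u v := by
  obtain ⟨D, hDinv, hDf⟩ := hinv
  obtain ⟨Θ, hΘ, hΘb, hΘm, hΘm', hdΘ⟩ := hq.exists_coframe hs (f x)
  set y₀ := extChartAt 𝓘(ℝ, F) (f x) (f x) with hy₀
  set z₀ := extChartAt 𝓘(ℝ, E') x x
  set φ := writtenInExtChartAt 𝓘(ℝ, E') 𝓘(ℝ, F) x f with hφdef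
  let D' : G ⧸ H → Submodule ℝ F := D
  have hD' : ∀ (b : G) (X : E), orbitDeriv E H F b X ∈ D' (b : G ⧸ H) ↔
      orbitDeriv E H F 1 X ∈ D' ((1 : G) : G ⧸ H) := hq.orbitDeriv_mem_iff hDinv
  have hDf' : ∀ x' : N, (modelDeriv E' F f x').toLinearMap.range = D' (f x') := hDf
  -- By invariance, the distribution pulls back under every orbit derivative to this same subspace.
  let 𝔡 : Submodule ℝ E := (D' ((1 : G) : G ⧸ H)).comap (orbitDeriv E H F 1).toLinearMap
  have hφ0 : φ z₀ = y₀ := writtenInExtChartAt_self f x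
  have hφs : SmoothAt E' F φ z₀ := smoothAt_writtenInExtChartAt (hf x)
  have hφd : fderiv ℝ φ z₀ = modelDeriv E' F f x := fderiv_writtenInExtChartAt (hf x)
  have hmem : ∀ᶠ z in 𝓝 z₀, ∀ v, Θ (φ z) (fderiv ℝ φ z v) ∈ 𝔡 := by
    have ht : Tendsto φ (𝓝 z₀) (𝓝 y₀) := by
      rw [← hφ0]
      exact hφs.continuousAt
    filter_upwards [ht.eventually hΘb, eventually_modelDeriv_symm_mem_range hf x] with z hz hz' v
    obtain ⟨b, hb, hbv⟩ := hz
    obtain ⟨x', hx', hr⟩ := hz'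
    have h1 := hr v
    rw [hDf', hx', ← hφdef, ← hb, ← hbv] at h1
    exact (hD' b _).1 h1
  have hφ2 : ContDiffAt ℝ 2 φ z₀ := (smoothAt_iff_contDiffAt.1 hφs).of_le ENat.LEInfty.out
  have h2 := second_deriv_mem_of_coframe hφ2 (by rw [hφ0]; exact hΘ) 𝔡 hmem u v
  -- The symmetrized derivative of `Θ` is `Θ` of the Christoffel symbol, so `h2` says that `Θ` sends
  -- the covariant derivative into `𝔡`.
  rw [hφ0, ← coframe_christoffel hs hq hB hnat hΘ hΘb hΘm hΘm' hdΘ, ← map_add, hφd] at h2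
  obtain ⟨a, ha, hav⟩ := hΘb.self_of_nhds
  have h3 := (hD' a _).2 h2
  rw [hav, hy₀, modelDeriv_extChartAt_symm, ha, hy₀, extChartAt_to_inv, ← hDf'] at h3
  obtain ⟨w, hw⟩ := h3
  exact ⟨w, hw⟩

end ThreeSymmetric

/-! ### From a tangential covariant derivative to a vanishing second fundamental form. -/

section PseudoRiemannian

variable {F : Type*} [NormedAddCommGroup F] [NormedSpace ℝ F]
  {M : Type*} [TopologicalSpace M] [ChartedSpace F M]
  {E' : Type*} [NormedAddCommGroup E'] [NormedSpace ℝ E'] [FiniteDimensional ℝ E']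
  {N : Type*} [TopologicalSpace N] [ChartedSpace E' N]

/-- For `df w`, the equation defining the tangential component is `(f^*g)(u, ·) = (f^*g)(w, ·)`,
whose only solution is `u = w` by nondegeneracy. -/
theorem tangentPart_mfderiv {g : BilinField F M} {f : N → M} {x : N}
    (hnd : ∀ u : E', (∀ v, (inducedMetric (E' := E') g f x : E' →L[ℝ] E' →L[ℝ] ℝ) u v = 0) → u = 0)
    (w : E') : tangentPart E' g f x (modelDeriv E' F f x w) = (modelDeriv E' F f x w : F) := by
  have h := inverse_apply_apply_of_injective (E := E')
    (inducedMetric (E' := E') g f x : E' →L[ℝ] E' →L[ℝ] ℝ) hnd w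
  exact congrArg (modelDeriv E' F f x) h

theorem IsTotallyGeodesic.isMinimal {g : BilinField F M} {f : N → M}
    (h : IsTotallyGeodesic (E' := E') g f) : IsMinimal (E' := E') g f :=
  fun x => Finset.sum_eq_zero fun _ _ => h x _ _

end PseudoRiemannian

end

theorem mainTheorem5
    {E : Type*} [NormedAddCommGroup E] [NormedSpace ℝ E] [FiniteDimensional ℝ E]
    {G : Type*} [TopologicalSpace G] [ChartedSpace E G] [Group G]
    [LieGroup 𝓘(ℝ, E) ∞ G] [ConnectedSpace G]
    (s : MulAut G) (H : Subgroup G) (hsH : IsThreeSymmetricPair (E := E) s H)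
    {F : Type*} [NormedAddCommGroup F] [NormedSpace ℝ F] [FiniteDimensional ℝ F]
    [ChartedSpace F (G ⧸ H)] [IsManifold 𝓘(ℝ, F) ∞ (G ⧸ H)]
    (hquot : IsQuotientManifold E F H)
    (B : mPart (E := E) s →L[ℝ] mPart (E := E) s →L[ℝ] ℝ)
    (hB : IsInvariantScalarProduct s H B) (hnat : IsNaturallyReductive s B)
    {E' : Type*} [NormedAddCommGroup E'] [NormedSpace ℝ E'] [FiniteDimensional ℝ E']
    {L : Type*} [TopologicalSpace L] [ChartedSpace E' L] [IsManifold 𝓘(ℝ, E') ∞ L]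
    (f : L → G ⧸ H)
    (hLag : IsLagrangian (E' := E') (invariantMetric (F := F) (H := H) s B)
      (invariantComplex (E := E) (F := F) (H := H) s) f)
    (hinv : IsInvariantSubmanifold (F := F) (E' := E') f) :
    IsTotallyGeodesic (E' := E') (invariantMetric (F := F) (H := H) s B) f ∧
      IsMinimal (E' := E') (invariantMetric (F := F) (H := H) s B) f := by
  have hgeo : IsTotallyGeodesic (E' := E') (invariantMetric (F := F) (H := H) s B) f := by
    intro x u v
    obtain ⟨w, hw⟩ := covDerivAlong_mem_range (E' := E') hsH hquot hB hnat
      (fun x => hLag.immersion.contMDiff.contMDiffAt) hinv x u v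
    have h := tangentPart_mfderiv (E' := E') (hLag.nondegenerate x) w
    -- The covariant derivative equals `df w`, hence its own tangential component.
    rw [secondFundamentalForm, sub_eq_zero]
    rw [hw] at h
    exact h.symm
  exact ⟨hgeo, hgeo.isMinimal⟩
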